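/- Let $r, m \ge 1$ be integers and let $\ell \ge r+5$ be a prime. Define integers $p_r(k)$ by $\prod_{n\ge 1}(1-q^n)^{-r}=\sum_{k\ge 0}p_r(k)q^k$, and put $p_r(x)=0$ for every rational $x$ that is not a nonnegative integer. For $b\ge 0$ let $$P_\ell(r,b;z)=\sum_{n\ge 0}p_r\!\left(\frac{\ell^b n+r}{24}\right)q^{n/24},\qquad \eta(z)=q^{1/24}\prod_{n\ge1}(1-q^n),\qquad q=e^{2\pi i z},$$ and, reading these as formal series in $q^{1/24}$ with coefficients reduced modulo $\ell^m$, let $$\Lambda_\ell^{\mathrm{odd}}(r,b,m)=\operatorname{Span}_{\mathbb Z/\ell^m\mathbb Z}\{\eta(\ell z)^rP_\ell(r,\beta;z) \bmod \ell^m:\ \beta\ge b\ \text{odd}\},$$ $$\Lambda_\ell^{\mathrm{even}}(r,b,m)=\operatorname{Span}_{\mathbb Z/\ell^m\mathbb Z}\{\eta(z)^rP_\ell(r,\beta;z)\bmod \ell^m:\ \beta\ge b\ \text{even}\}.$$ Then there is an integer $b'\ge 0$ such that $\Lambda_\ell^{\mathrm{odd}}(r,2b+1,m)$ is the same module for all $b\ge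 0$ with $2b+1\ge b'$ and $\Lambda_\ell^{\mathrm{even}}(r,2b,m)$ is the same module for all $b\ge 0$ with $2b\ge b'$. Let $b_\ell(r,m)$ be the least such $b'$, let $\Omega_\ell^{\mathrm{odd}}(r,m)=\bigcap_{b\ge 0}\Lambda_\ell^{\mathrm{odd}}(r,2b+1,m)$ be the stable value of the odd sequence, and let $r_\ell(r)$ be its rank, that is, the minimal number of generators of $\Omega_\ell^{\mathrm{odd}}(r,m)$ as a $\mathbb Z/\ell^m\mathbb Z$-module. Suppose that $r_\ell(r)\le 1$. If $b_1,b_2\ge b_\ell(r,m)$ and $b_1\equiv b_2\pmod 2$, then there is an integer $C=C_\ell(r,b_1,b_2,m)$ such that for all integers $n\ge 0$ $$p_r\!\left(\frac{\ell^{b_1}n+r}{24}\right)\equiv C\cdot p_r\!\left(\frac{\ell^{b_2}n+r}{24}\right)\pmod{\ell^m}.$$ If $r_\ell(r)=0$, then this holds with $C=0$. -/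

import Mathlib

namespace PartitionPowers

open PowerSeries

open scoped PowerSeries.WithPiTopology in
/-- Euler's product `∏_{n ≥ 1} (1 - q^n)` as a formal power series with integer coefficients. -/
noncomputable def eulerProduct : ℤ⟦X⟧ := ∏' n : ℕ, (1 - (X : ℤ⟦X⟧) ^ (n + 1))

theorem constantCoeff_eulerProduct : constantCoeff eulerProduct = 1 := by
  have h : eulerProduct = pentagonalSeries ℤ :=
    PowerSeries.WithPiTopology.tprod_one_sub_X_pow ℤ
  rw [h, ← coeff_zero_eq_constantCoeff_apply]
  have h0 : pentagonal 0 = 0 := by decide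
  have h1 := coeff_pentagonalSeries_pentagonal ℤ 0
  rw [h0] at h1
  rw [h1]
  simp

/-- The generating function `∏_{n ≥ 1} 1 / (1 - q^n)` of the partition function. -/
noncomputable def partitionSeries : ℤ⟦X⟧ := invOfUnit eulerProduct 1

theorem eulerProduct_mul_partitionSeries : eulerProduct * partitionSeries = 1 :=
  mul_invOfUnit _ _ (by simp [constantCoeff_eulerProduct])

/-- `p_r(x)` for a rational argument `x`: the coefficient of `q^x` in `∏ 1 / (1 - q^n)^r` if `x` is
a nonnegative integer, and `0` otherwise. -/
noncomputable def pPow (r : ℕ) (x : ℚ) : ℤ :=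
  if x.den = 1 ∧ 0 ≤ x then coeff x.num.toNat (partitionSeries ^ r) else 0

theorem pPow_natCast (r k : ℕ) : pPow r (k : ℚ) = coeff k (partitionSeries ^ r) := by
  simp [pPow]

theorem pPow_natCast_div_of_not_dvd (r N : ℕ) (h : ¬ 24 ∣ N) : pPow r ((N : ℚ) / 24) = 0 := by
  have h1 : ((N : ℚ) / 24).den ≠ 1 := by
    intro hd
    apply h
    have h2 : (((N : ℚ) / 24).num : ℚ) = (N : ℚ) / 24 := Rat.den_eq_one_iff _ |>.mp hd
    have h3 : (N : ℤ) = 24 * ((N : ℚ) / 24).num := by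
      have : (N : ℚ) = 24 * (((N : ℚ) / 24).num : ℚ) := by rw [h2]; ring
      exact_mod_cast this
    omega
  simp [pPow, h1]

/-- The expansion of `η(d z) = q^{d/24} ∏ (1 - q^{d n})`, for `d ≥ 1`, as a formal power series in
the variable `X = q^{1/24}`. -/
noncomputable def etaSeries (d : ℕ) : ℤ⟦X⟧ :=
  (X : ℤ⟦X⟧) ^ d * eulerProduct.subst ((X : ℤ⟦X⟧) ^ (24 * d))

/-- The generating function `P_ℓ(r, b; z) = ∑_{n ≥ 0} p_r((ℓ^b n + r) / 24) q^{n/24}` as a formal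
power series in the variable `X = q^{1/24}`. -/
noncomputable def PSeries (ℓ r b : ℕ) : ℤ⟦X⟧ :=
  PowerSeries.mk fun n => pPow r (((ℓ : ℚ) ^ b * n + r) / 24)

/-- Reduction modulo `ℓ^m` of the coefficients of a power series. -/
noncomputable def reduce (ℓ m : ℕ) : ℤ⟦X⟧ →+* (ZMod (ℓ ^ m))⟦X⟧ :=
  PowerSeries.map (Int.castRingHom (ZMod (ℓ ^ m)))

/-- `Λ_ℓ^odd(r, b, m)`: the `ℤ/ℓ^m`-span of the reductions of `η(ℓ z)^r P_ℓ(r, β; z)` over the odd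
`β ≥ b`. -/
noncomputable def LambdaOdd (ℓ r b m : ℕ) :
    Submodule (ZMod (ℓ ^ m)) (ZMod (ℓ ^ m))⟦X⟧ :=
  Submodule.span _ {f | ∃ β : ℕ, b ≤ β ∧ Odd β ∧
    f = reduce ℓ m (etaSeries ℓ ^ r * PSeries ℓ r β)}

/-- `Λ_ℓ^even(r, b, m)`: the `ℤ/ℓ^m`-span of the reductions of `η(z)^r P_ℓ(r, β; z)` over the even
`β ≥ b`. -/
noncomputable def LambdaEven (ℓ r b m : ℕ) :
    Submodule (ZMod (ℓ ^ m)) (ZMod (ℓ ^ m))⟦X⟧ :=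
  Submodule.span _ {f | ∃ β : ℕ, b ≤ β ∧ Even β ∧
    f = reduce ℓ m (etaSeries 1 ^ r * PSeries ℓ r β)}

/-- The thresholds `b'` from which on both nested sequences of modules are constant:
`Λ_ℓ^odd(r, 2b+1, m)` does not depend on `b` for `2b+1 ≥ b'`, and `Λ_ℓ^even(r, 2b, m)` does not
depend on `b` for `2b ≥ b'`. -/
def stableThresholds (ℓ r m : ℕ) : Set ℕ :=
  {b' | (∀ b c : ℕ, b' ≤ 2 * b + 1 → b' ≤ 2 * c + 1 →
          LambdaOdd ℓ r (2 * b + 1) m = LambdaOdd ℓ r (2 * c + 1) m) ∧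
        (∀ b c : ℕ, b' ≤ 2 * b → b' ≤ 2 * c →
          LambdaEven ℓ r (2 * b) m = LambdaEven ℓ r (2 * c) m)}

/-- `b_ℓ(r, m)`: the least threshold of stabilization. -/
noncomputable def bMin (ℓ r m : ℕ) : ℕ := sInf (stableThresholds ℓ r m)

/-- `Ω_ℓ^odd(r, m)`: the stable value of the decreasing sequence `Λ_ℓ^odd(r, 2b+1, m)`, that is,
its intersection. -/
noncomputable def OmegaOdd (ℓ r m : ℕ) : Submodule (ZMod (ℓ ^ m)) (ZMod (ℓ ^ m))⟦X⟧ :=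
  ⨅ b : ℕ, LambdaOdd ℓ r (2 * b + 1) m

theorem LambdaOdd_anti (ℓ r m : ℕ) {b c : ℕ} (h : b ≤ c) :
    LambdaOdd ℓ r c m ≤ LambdaOdd ℓ r b m :=
  Submodule.span_mono fun _ ⟨β, h1, h2, h3⟩ => ⟨β, h.trans h1, h2, h3⟩

theorem OmegaOdd_eq (ℓ r m b' b : ℕ) (hb' : b' ∈ stableThresholds ℓ r m) (h : b' ≤ 2 * b + 1) :
    OmegaOdd ℓ r m = LambdaOdd ℓ r (2 * b + 1) m := by
  refine le_antisymm (iInf_le _ b) (le_iInf fun c => ?_)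
  rw [hb'.1 b (max b c) h (by omega)]
  exact LambdaOdd_anti ℓ r m (by omega)

/-- The rank `r_ℓ(r)`, at level `m`: the minimal number of generators of the
`ℤ/ℓ^m`-module `Ω_ℓ^odd(r, m)`. -/
noncomputable def rankOmega (ℓ r m : ℕ) : Cardinal := (OmegaOdd ℓ r m).spanRank

end PartitionPowers

/-!
Modulo `ℓ^m` the series `P_ℓ(r, b)` form an orbit of the operator `U_ℓ` in a finite module. The
congruences hold because, when the orbit of an element under an endomorphism spans a cyclic module,
that element is a generator of it.

Write `X = q^{1/24}`. From the definition `P_ℓ(r, b + 1) = U_ℓ P_ℓ(r, b)`, where `U_ℓ` sends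
`∑ a(n) X^n` to `∑ a(ℓ n) X^n`. Multiplication by `η(z)^r` or `η(ℓz)^r` is injective modulo `ℓ^m`,
so `Λ_ℓ^odd` and `Λ_ℓ^even` may be replaced by the spans of the `P_ℓ(r, β)` themselves, that is, by
spans of orbits of `U_{ℓ^2}`.

*Finiteness.* Let `V(κ)` be the span over `ℤ/ℓ^m` of the forms `η^w E₄^a` with `w + 8a = κ`,
a finite module. If `κ ≥ 2(m + 2)`, then `U_{ℓ^2}` preserves `V(κ)` (`exists_formSpan_opU`,
`opU_mem_formMod`): the sum of the translates of `f = η^w E₄^a` under the matrices of determinant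
`ℓ^2` is `ℓ^2 U_{ℓ^2} f` up to terms divisible by `ℓ^(m+2)` (`exists_hasExp_heckeSum`), and it
transforms under `z ↦ z + 1` and `z ↦ -1/z` like `f` (`heckeSum_add_one`, `heckeSum_neg_one_div`).
The latter rests on the behaviour of `η` under `z ↦ -1/z` at the points `(z + 24b)/N`
(`eta_neg_one_div_add`), obtained from the pentagonal number theorem, the functional equation of
the theta function and Gauss sums modulo `ℓ` and `ℓ^2`. After multiplication by a power of `η` the
result is a form of level one, and these are, modulo `ℓ^m`, integral combinations of the
`Δ^i E₄^j` (`IsLevelOne.exists_isCongr_formSpan`). All the forms in question are kept together with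
their expansions by the predicate `HasExp`.

*Starting point.* Since `η^(ℓ^(m+1)) ≡ η(ℓ^2 z)^(ℓ^(m-1))` modulo `ℓ^m`, applying `U_{ℓ^2}` to
`η^(ℓ^(m+1) - r)` gives `η^(ℓ^(m-1)) P_ℓ(r, 2)` (`opU_etaSeries_pow`). The generators of `V(κ)` are
in echelon form, so that the power of `η` can be cancelled, and `P_ℓ(r, 2)` lies in some `V(κ)`.
Hence so do all `P_ℓ(r, 2j)` with `j ≥ 1`, and both nested sequences stabilise.

*Congruences.* If the stable span is cyclic, generated by `g`, and `P_ℓ(r, b) = c g`, then applying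
`U_{ℓ^2}` repeatedly shows that the whole orbit of `P_ℓ(r, b)` lies in `c • span {g}`, so that
`P_ℓ(r, b)` is itself a generator (`stepSpan_eq_span_singleton`). As `U_ℓ` maps the stable odd span
onto the stable even one, the hypothesis on `Ω_ℓ^odd` serves both parities.
-/

namespace PartitionPowers

open PowerSeries

/-! ### Expansions in powers of `q^{1/24}` -/

/-- The normalised exponential `e(x) = exp(2πix)`. -/
noncomputable def ex (x : ℂ) : ℂ := Complex.exp (2 * Real.pi * Complex.I * x)

theorem ex_add (x y : ℂ) : ex (x + y) = ex x * ex y := by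
  rw [ex, ex, ex, ← Complex.exp_add]
  ring_nf

theorem ex_intCast (n : ℤ) : ex n = 1 := by
  rw [ex, mul_comm]
  exact Complex.exp_int_mul_two_pi_mul_I n

theorem ex_natCast (n : ℕ) : ex n = 1 := by simpa using ex_intCast n

theorem ex_pow (x : ℂ) (n : ℕ) : ex x ^ n = ex (n * x) := by
  rw [ex, ex, ← Complex.exp_nat_mul]
  ring_nf

theorem norm_ex (x : ℂ) : ‖ex x‖ = Real.exp (-2 * Real.pi * x.im) := by
  rw [ex, Complex.norm_exp]
  simp

theorem norm_ex_lt_one {x : ℂ} (hx : 0 < x.im) : ‖ex x‖ < 1 := by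
  rw [norm_ex, Real.exp_lt_one_iff]
  nlinarith [Real.pi_pos]

theorem ex_eq_of_sub {x y : ℂ} (n : ℤ) (h : x - y = n) : ex x = ex y := by
  rw [show x = y + n by rw [← h]; ring, ex_add, ex_intCast, mul_one]

theorem exists_ex_eq {q : ℂ} (h0 : q ≠ 0) (h1 : ‖q‖ < 1) : ∃ z : ℂ, 0 < z.im ∧ ex (z / 24) = q := by
  refine ⟨Function.Periodic.invQParam 24 q,
    Function.Periodic.im_invQParam_pos_of_norm_lt_one (by norm_num) h1 h0, ?_⟩
  have := Function.Periodic.qParam_right_inv (h := 24) (by norm_num) h0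
  rw [Function.Periodic.qParam] at this
  rw [ex, ← mul_div_assoc]
  exact_mod_cast this

/-- `F` is given on the upper half plane by the power series `φ` in `q^{1/24}`. -/
def HasExp (F : ℂ → ℂ) (φ : ℂ⟦X⟧) : Prop :=
  ∀ z : ℂ, 0 < z.im → HasSum (fun n => coeff n φ * ex (z / 24) ^ n) (F z)

/-- The operator `U_N` on power series: `∑ a(n) X^n ↦ ∑ a(N n) X^n`. -/
noncomputable def opU (R : Type*) [CommSemiring R] (N : ℕ) : R⟦X⟧ →ₗ[R] R⟦X⟧ where
  toFun φ := PowerSeries.mk fun n => coeff (N * n) φ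
  map_add' φ ψ := by ext n; simp
  map_smul' c φ := by ext n; simp

@[simp] theorem coeff_opU {R : Type*} [CommSemiring R] (N n : ℕ) (φ : R⟦X⟧) :
    coeff n (opU R N φ) = coeff (N * n) φ := by simp [opU]

namespace HasExp

variable {F G : ℂ → ℂ} {φ ψ : ℂ⟦X⟧}

theorem congr (hF : HasExp F φ) (h : ∀ z : ℂ, 0 < z.im → F z = G z) : HasExp G φ := by
  intro z hz
  rw [← h z hz]
  exact hF z hz

theorem add (hF : HasExp F φ) (hG : HasExp G ψ) : HasExp (fun z => F z + G z) (φ + ψ) := by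
  intro z hz
  simpa [add_mul] using (hF z hz).add (hG z hz)

theorem smul (c : ℂ) (hF : HasExp F φ) : HasExp (fun z => c * F z) (c • φ) := by
  intro z hz
  simpa [mul_assoc] using (hF z hz).mul_left c

theorem sub (hF : HasExp F φ) (hG : HasExp G ψ) : HasExp (fun z => F z - G z) (φ - ψ) := by
  intro z hz
  simpa [sub_mul] using (hF z hz).sub (hG z hz)

theorem one : HasExp (fun _ => 1) 1 := by
  intro z hz
  have := hasSum_single (f := fun n => coeff n (1 : ℂ⟦X⟧) * ex (z / 24) ^ n) 0
    (by intro b hb; simp [coeff_one, hb])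
  simpa using this

theorem mul (hF : HasExp F φ) (hG : HasExp G ψ) : HasExp (fun z => F z * G z) (φ * ψ) := by
  intro z hz
  have h1 := (hF z hz).summable.norm
  have h2 := (hG z hz).summable.norm
  have key : ∀ n, coeff n (φ * ψ) * ex (z / 24) ^ n =
      ∑ kl ∈ Finset.HasAntidiagonal.antidiagonal n, (coeff kl.1 φ * ex (z / 24) ^ kl.1) *
        (coeff kl.2 ψ * ex (z / 24) ^ kl.2) := by
    intro n
    rw [coeff_mul, Finset.sum_mul]
    refine Finset.sum_congr rfl fun kl hkl => ?_
    rw [← Finset.HasAntidiagonal.mem_antidiagonal.mp hkl, pow_add]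
    ring
  simp_rw [key]
  rw [← (hF z hz).tsum_eq, ← (hG z hz).tsum_eq,
    tsum_mul_tsum_eq_tsum_sum_antidiagonal_of_summable_norm h1 h2]
  exact (summable_norm_sum_mul_antidiagonal_of_summable_norm h1 h2).of_norm.hasSum

theorem pow (hF : HasExp F φ) (n : ℕ) : HasExp (fun z => F z ^ n) (φ ^ n) := by
  induction n with
  | zero => simpa using one
  | succ n ih => simpa [pow_succ] using ih.mul hF

theorem sum {ι : Type*} (s : Finset ι) {F : ι → ℂ → ℂ} {φ : ι → ℂ⟦X⟧}
    (h : ∀ i ∈ s, HasExp (F i) (φ i)) : HasExp (fun z => ∑ i ∈ s, F i z) (∑ i ∈ s, φ i) := by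
  intro z hz
  simp only [map_sum, Finset.sum_mul]
  exact hasSum_sum fun i hi => h i hi z hz

theorem comp_add (hF : HasExp F φ) {c : ℂ} (hc : c.im = 0) :
    HasExp (fun z => F (z + c)) (rescale (ex (c / 24)) φ) := by
  intro z hz
  have := hF (z + c) (by simpa [hc] using hz)
  convert this using 2 with n
  rw [coeff_rescale, add_div, ex_add]
  ring

theorem comp_natCast_mul (hF : HasExp F φ) {N : ℕ} (hN : N ≠ 0) :
    HasExp (fun z => F (N * z)) (expand N hN φ) := by
  intro z hz
  have h := hF (N * z) (by
    simp only [Complex.mul_im, Complex.natCast_re, Complex.natCast_im, zero_mul, add_zero]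
    positivity)
  have hinj : Function.Injective fun n : ℕ => N * n := fun a b hab =>
    Nat.eq_of_mul_eq_mul_left (Nat.pos_of_ne_zero hN) hab
  refine (hinj.hasSum_iff ?_).mp ?_
  · intro n hn
    rw [coeff_expand_of_not_dvd N hN φ fun ⟨k, hk⟩ => hn ⟨k, hk.symm⟩, zero_mul]
  · convert h using 2 with n
    simp only [Function.comp_apply]
    rw [coeff_expand_mul, mul_div_assoc, ← ex_pow, ← pow_mul]

/-- Averaging over the translates `(z + 24b)/N` picks out the coefficients whose index is divisible
by `N`. -/
theorem sum_comp_div (hF : HasExp F φ) {N : ℕ} (hN : N ≠ 0) :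
    HasExp (fun z => ∑ b ∈ Finset.range N, F ((z + 24 * b) / N)) ((N : ℂ) • opU ℂ N φ) := by
  intro z hz
  have hN' : (N : ℂ) ≠ 0 := by exact_mod_cast hN
  have h : ∀ b ∈ Finset.range N, HasSum
      (fun n => coeff n φ * (ex (z / N / 24) ^ n * ex (n / N) ^ b)) (F ((z + 24 * b) / N)) := by
    intro b _
    have := hF ((z + 24 * b) / N) (by
      rw [Complex.div_natCast_im]
      have : (z + 24 * (b : ℂ)).im = z.im := by simp
      rw [this]
      positivity)
    convert this using 2 with n
    rw [ex_pow, ex_pow, ex_pow, ← ex_add]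
    congr 2
    field_simp
  have hs := hasSum_sum h
  have hinj : Function.Injective fun n : ℕ => N * n := fun a b hab =>
    Nat.eq_of_mul_eq_mul_left (Nat.pos_of_ne_zero hN) hab
  have h3 := (hinj.hasSum_iff ?_).mpr hs
  · convert h3 using 2 with n
    have h1 : ex (((N * n : ℕ) : ℂ) / N) = 1 := by
      rw [Nat.cast_mul, mul_div_cancel_left₀ _ hN', ex_natCast]
    simp only [Function.comp_apply, coeff_smul, coeff_opU, h1, one_pow, mul_one, Finset.sum_const,
      Finset.card_range, nsmul_eq_mul, smul_eq_mul]
    rw [pow_mul, ex_pow _ N, show (N : ℂ) * (z / N / 24) = z / 24 by field_simp]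
    ring
  · intro n hn
    rw [← Finset.mul_sum, ← Finset.mul_sum]
    have h1 : ex (n / N) ≠ 1 := by
      intro h
      rw [ex, Complex.exp_eq_one_iff] at h
      obtain ⟨k, hk⟩ := h
      have h2 : (2 * Real.pi * Complex.I : ℂ) ≠ 0 := Complex.two_pi_I_ne_zero
      have h3 : (n : ℂ) = N * k := by
        have : (n : ℂ) / N = k := by
          apply mul_left_cancel₀ h2
          rw [hk]; ring
        rw [← this]; field_simp
      have h4 : (n : ℤ) = N * k := by exact_mod_cast h3
      have h5 : N ∣ n := by
        have : (N : ℤ) ∣ n := ⟨k, h4⟩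
        exact_mod_cast this
      exact hn (by obtain ⟨j, hj⟩ := h5; exact ⟨j, hj.symm⟩)
    have h2 : ex (n / N) ^ N = 1 := by
      rw [ex_pow, mul_div_cancel₀ _ hN', ex_natCast]
    rw [geom_sum_eq h1, h2]
    simp

/-- Convergence on the upper half plane forces the radius of convergence to be at least `1`. -/
theorem hasFPowerSeriesOnBall (hF : HasExp F φ) :
    HasFPowerSeriesOnBall (fun q => ∑' n, coeff n φ * q ^ n)
      (FormalMultilinearSeries.ofScalars ℂ fun n => coeff n φ) 0 1 := by
  have hs : ∀ q : ℂ, ‖q‖ < 1 → Summable fun n => coeff n φ * q ^ n := by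
    intro q hq
    rcases eq_or_ne q 0 with rfl | h0
    · refine summable_of_ne_finset_zero (s := {0}) fun n hn => ?_
      simp at hn
      simp [hn]
    · obtain ⟨z, hz, rfl⟩ := exists_ex_eq h0 hq
      exact (hF z hz).summable
  constructor
  · refine le_of_forall_lt_imp_le_of_dense fun r hr => ?_
    lift r to NNReal using hr.ne_top
    apply FormalMultilinearSeries.le_radius_of_summable
    have := (hs (r : ℂ) (by simpa using hr)).norm
    simpa using this
  · simp
  · intro y hy
    have hy' : ‖y‖ < 1 := by
      rw [← ENNReal.coe_one, Metric.eball_coe, NNReal.coe_one, mem_ball_zero_iff] at hy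
      exact hy
    simpa [mul_comm] using (hs y hy').hasSum

/-- Every `q` in the punctured unit disc is of the form `e(z/24)`, so that the expansion is
determined by the identity theorem. -/
theorem unique (hF : HasExp F φ) (hG : HasExp F ψ) : φ = ψ := by
  have h : HasExp (fun _ => 0) (φ - ψ) := by simpa using hF.sub hG
  have hp := h.hasFPowerSeriesOnBall.hasFPowerSeriesAt
  have h0 : (fun q => ∑' n, coeff n (φ - ψ) * q ^ n) =ᶠ[nhds 0] fun _ => (0 : ℂ) := by
    have ha := hp.analyticAt
    refine (ha.frequently_eq_iff_eventually_eq analyticAt_const).mp ?_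
    refine Filter.Eventually.frequently ?_
    rw [eventually_nhdsWithin_iff]
    filter_upwards [Metric.ball_mem_nhds (0 : ℂ) one_pos] with q hq h0
    obtain ⟨z, hz, rfl⟩ := exists_ex_eq h0 (by simpa using hq)
    exact (h z hz).tsum_eq
  have h1 := (hp.congr h0).eq_zero
  rw [← sub_eq_zero]
  ext n
  have h2 : FormalMultilinearSeries.coeff (0 : FormalMultilinearSeries ℂ ℂ ℂ) n = 0 := by
    simp [FormalMultilinearSeries.coeff]
  simpa [h2] using congr_arg (FormalMultilinearSeries.coeff · n) h1

theorem differentiableOn (hF : HasExp F φ) : DifferentiableOn ℂ F {z | 0 < z.im} := by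
  have h1 := hF.hasFPowerSeriesOnBall.differentiableOn
  have h2 : DifferentiableOn ℂ (fun z : ℂ => ex (z / 24)) {z | 0 < z.im} := by
    unfold ex
    fun_prop
  refine (h1.comp h2 fun z hz => ?_).congr fun z hz => ((hF z hz).tsum_eq).symm
  have : ‖ex (z / 24)‖ < 1 := norm_ex_lt_one (by
    have : (z / 24).im = z.im / 24 := by simp
    rw [this]; exact div_pos hz (by norm_num))
  rw [← ENNReal.coe_one, Metric.eball_coe, NNReal.coe_one, mem_ball_zero_iff]
  exact this

end HasExp

/-! ### The expansion of the Dedekind eta function -/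

/-- A bound, uniform in `k` and `n`, for the products in the remainder terms of the pentagonal
number theorem. -/
theorem norm_prod_one_sub_pow_le {x : ℂ} (hx : ‖x‖ < 1) (k n : ℕ) :
    ‖∏ i ∈ Finset.range n, (1 - x ^ (k + i + 1))‖ ≤ Real.exp (1 - ‖x‖)⁻¹ := by
  calc ‖∏ i ∈ Finset.range n, (1 - x ^ (k + i + 1))‖
      ≤ ∏ i ∈ Finset.range n, Real.exp (‖x‖ ^ i) := by
        rw [norm_prod]
        refine Finset.prod_le_prod (fun _ _ => norm_nonneg _) fun i _ => ?_
        calc ‖1 - x ^ (k + i + 1)‖ ≤ 1 + ‖x‖ ^ (k + i + 1) := by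
              simpa using norm_sub_le (1 : ℂ) (x ^ (k + i + 1))
          _ ≤ ‖x‖ ^ i + 1 := by
              rw [add_comm]
              gcongr 1
              · exact pow_le_pow_of_le_one (norm_nonneg _) hx.le (by omega)
          _ ≤ _ := Real.add_one_le_exp _
    _ = Real.exp (∑ i ∈ Finset.range n, ‖x‖ ^ i) := (Real.exp_sum _ _).symm
    _ ≤ _ := by
        rw [Real.exp_le_exp, ← tsum_geometric_of_lt_one (norm_nonneg _) hx]
        exact (summable_geometric_of_lt_one (norm_nonneg _) hx).sum_le_tsum _
          fun _ _ => by positivity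

theorem summable_negOnePow_mul_pow_pentagonal {x : ℂ} (hx : ‖x‖ < 1) :
    Summable fun k : ℤ => (Int.negOnePow k : ℂ) * x ^ pentagonal k := by
  have h : Summable fun k : ℤ => ‖x‖ ^ pentagonal k :=
    (summable_geometric_of_lt_one (norm_nonneg _) hx).comp_injective pentagonal_injective
  refine Summable.of_norm_bounded h fun k => ?_
  rcases Int.even_or_odd k with hk | hk <;> simp [Int.negOnePow_even, Int.negOnePow_odd, hk]

/-- Euler's pentagonal number theorem for a complex number in the open unit disc. -/
theorem hasSum_pentagonal {x : ℂ} (hx : ‖x‖ < 1) :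
    HasSum (fun k : ℤ => (Int.negOnePow k : ℂ) * x ^ pentagonal k)
      (∏' n : ℕ, (1 - x ^ (n + 1))) := by
  have hgeo := summable_geometric_of_lt_one (norm_nonneg _) hx
  have hZ := (summable_negOnePow_mul_pow_pentagonal hx).hasSum
  have hN : HasSum (fun k : ℕ => (-1) ^ k * (x ^ pentagonal (-k) - x ^ pentagonal (k + 1)))
      (∑' k : ℤ, (Int.negOnePow k : ℂ) * x ^ pentagonal k) := by
    have h := hZ
    rw [← neg_injective.hasSum_iff (fun y hy ↦ by absurd hy; use -y; simp)] at h
    convert h.nat_add_neg_add_one using 2 with k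
    simp_rw [Function.comp_apply, neg_neg, Int.negOnePow_add]
    simp
    ring
  have hbound : ∀ k n : ℕ, ‖x ^ ((k + 1) * n) * ∏ i ∈ Finset.range (n + 1), (1 - x ^ (k + i + 1))‖
      ≤ ‖x‖ ^ n * Real.exp (1 - ‖x‖)⁻¹ := by
    intro k n
    rw [norm_mul, norm_pow]
    refine mul_le_mul ?_ (norm_prod_one_sub_pow_le hx k (n + 1)) (norm_nonneg _) (by positivity)
    exact pow_le_pow_of_le_one (norm_nonneg _) hx.le (by nlinarith)
  rw [Pentagonal.tprod_one_sub_pow (x := x)]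
  · rw [hN.tsum_eq]
    exact hZ
  · exact tendsto_pow_atTop_nhds_zero_of_norm_lt_one hx
  · exact fun k => Summable.of_norm_bounded (hgeo.mul_right _) (hbound k)
  · intro k
    have : Summable fun n : ℕ => ‖-x ^ (n + k + 1)‖ := by
      simp only [norm_neg, norm_pow, add_assoc]
      exact (summable_nat_add_iff (k + 1)).mpr hgeo
    simpa [sub_eq_add_neg] using multipliable_one_add_of_summable this
  · exact hN.summable
  · have h0 : Filter.Tendsto (fun k : ℕ => ‖x‖ ^ k * (∑' n : ℕ, ‖x‖ ^ n * Real.exp (1 - ‖x‖)⁻¹))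
        Filter.atTop (nhds 0) := by
      simpa using (tendsto_pow_atTop_nhds_zero_of_lt_one (norm_nonneg _) hx).mul_const
        (∑' n : ℕ, ‖x‖ ^ n * Real.exp (1 - ‖x‖)⁻¹)
    refine squeeze_zero_norm (fun k => ?_) h0
    rw [norm_mul, norm_mul, norm_pow, norm_neg, norm_one, one_pow, one_mul, norm_pow]
    refine mul_le_mul ?_ ?_ (norm_nonneg _) (by positivity)
    · refine pow_le_pow_of_le_one (norm_nonneg _) hx.le ?_
      rw [Nat.le_div_iff_mul_le (by norm_num)]
      nlinarith
    · exact tsum_of_norm_bounded ((hgeo.mul_right _).hasSum) (hbound k)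

theorem eulerProduct_eq_pentagonalSeries : eulerProduct = pentagonalSeries ℤ :=
  PowerSeries.WithPiTopology.tprod_one_sub_X_pow ℤ

theorem hasSum_eulerProduct {x : ℂ} (hx : ‖x‖ < 1) :
    HasSum (fun n => ((coeff n eulerProduct : ℤ) : ℂ) * x ^ n) (∏' n : ℕ, (1 - x ^ (n + 1))) := by
  rw [eulerProduct_eq_pentagonalSeries, ← pentagonal_injective.hasSum_iff]
  · convert hasSum_pentagonal hx using 2 with k
    simp
  · intro n hn
    simp [coeff_pentagonalSeries_eq_zero ℤ hn]

/-- The integer series `f`, with coefficients viewed as complex numbers. -/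
noncomputable abbrev toC : ℤ⟦X⟧ →+* ℂ⟦X⟧ := PowerSeries.map (Int.castRingHom ℂ)

theorem etaSeries_eq_expand {d : ℕ} (hd : d ≠ 0) :
    etaSeries d = X ^ d * expand (24 * d) (by omega) eulerProduct := by
  rw [etaSeries, expand_apply]

theorem hasExp_X : HasExp (fun z => ex (z / 24)) X := by
  intro z hz
  have := hasSum_single (f := fun n => coeff n (X : ℂ⟦X⟧) * ex (z / 24) ^ n) 1
    (by intro b hb; simp [coeff_X, hb])
  simpa using this

theorem eta_eq (z : ℂ) : ModularForm.eta z = ex (z / 24) * ∏' n : ℕ, (1 - ex z ^ (n + 1)) := by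
  simp only [ModularForm.eta, ModularForm.eta_q_eq_pow]
  congr 1
  rw [Function.Periodic.qParam, ex, ← mul_div_assoc]
  norm_cast

theorem div_24_im (z : ℂ) : (z / 24).im = z.im / 24 := by simp

theorem hasExp_eta : HasExp ModularForm.eta (toC (etaSeries 1)) := by
  have h1 : HasExp (fun z => ∏' n : ℕ, (1 - ex (z / 24) ^ (n + 1))) (toC eulerProduct) := by
    intro z hz
    have h0 : ‖ex (z / 24)‖ < 1 := norm_ex_lt_one (by rw [div_24_im]; positivity)
    simpa using hasSum_eulerProduct h0
  have h2 := hasExp_X.mul (h1.comp_natCast_mul (N := 24) (by norm_num))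
  have h3 : toC (etaSeries 1) = X * expand 24 (by norm_num) (toC eulerProduct) := by
    rw [etaSeries_eq_expand one_ne_zero, map_mul, map_expand]
    simp
  rw [h3]
  refine h2.congr fun z _ => ?_
  rw [eta_eq]
  congr! 5
  push_cast
  congr 1
  ring

/-- `η` as a theta series over all integers congruent to `-1` modulo `6`. -/
theorem hasSum_eta {z : ℂ} (hz : 0 < z.im) :
    HasSum (fun k : ℤ => (Int.negOnePow k : ℂ) * ex ((6 * k - 1) ^ 2 * z / 24))
      (ModularForm.eta z) := by
  rw [eta_eq]
  refine ((hasSum_pentagonal (norm_ex_lt_one hz)).mul_left (ex (z / 24))).congr_fun fun k => ?_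
  have h' : 2 * (pentagonal k : ℂ) = k * (3 * k - 1) := by
    exact_mod_cast two_mul_natCast_pentagonal k
  rw [mul_left_comm, ex_pow, ← ex_add]
  congr 2
  linear_combination (-z / 2) * h'

/-! ### Theta series with periodic coefficients -/

/-- A sum over `ℤ` may be computed one residue class at a time. -/
theorem hasSum_int_of_residues {M : ℕ} [NeZero M] {f : ℤ → ℂ} {s : ZMod M → ℂ}
    (h : ∀ j : ZMod M, HasSum (fun n : ℤ => f (M * n + j.val)) (s j)) :
    HasSum f (∑ j, s j) := by
  have hM : (M : ℤ) ≠ 0 := by exact_mod_cast NeZero.ne M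
  have h1 : ∀ j : ZMod M, HasSum (fun m : ℤ => if (m : ZMod M) = j then f m else 0) (s j) := by
    intro j
    have hinj : Function.Injective fun n : ℤ => (M : ℤ) * n + j.val := fun a b hab => by
      have hab' : (M : ℤ) * a + j.val = M * b + j.val := hab
      exact mul_left_cancel₀ hM (by omega)
    rw [← hinj.hasSum_iff]
    · refine (h j).congr_fun fun n => ?_
      simp
    · intro m hm
      rw [if_neg]
      intro hj
      apply hm
      have h2 : ((m - j.val : ℤ) : ZMod M) = 0 := by simp [hj]
      rw [ZMod.intCast_zmod_eq_zero_iff_dvd] at h2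
      obtain ⟨k, hk⟩ := h2
      exact ⟨k, by simp only; omega⟩
  refine (hasSum_sum (s := Finset.univ) fun j _ => h1 j).congr_fun fun m => ?_
  simp

/-- The weight one half automorphy factor `(-iz)^{1/2}`. -/
noncomputable def autJ (z : ℂ) : ℂ := (-Complex.I * z) ^ (1 / 2 : ℂ)

theorem neg_I_mul_ne_zero {z : ℂ} (hz : 0 < z.im) : -Complex.I * z ≠ 0 := by
  intro h
  have : z = 0 := by simpa using h
  simp [this] at hz

theorem autJ_ne_zero {z : ℂ} (hz : 0 < z.im) : autJ z ≠ 0 := by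
  rw [autJ, Ne, Complex.cpow_eq_zero_iff]
  exact fun h => neg_I_mul_ne_zero hz h.1

theorem autJ_sq (z : ℂ) : autJ z ^ 2 = -Complex.I * z := by
  rw [autJ, ← Complex.cpow_nat_mul]
  norm_num

theorem autJ_pow_eight (z : ℂ) : autJ z ^ 8 = z ^ 4 := by
  rw [show 8 = 2 * 4 from rfl, pow_mul, autJ_sq, mul_pow]
  have : (-Complex.I) ^ 4 = 1 := by rw [Even.neg_pow (by decide), Complex.I_pow_four]
  rw [this, one_mul]

theorem autJ_ofReal_mul {a : ℝ} (ha : 0 < a) {z : ℂ} (hz : 0 < z.im) :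
    autJ (a * z) = (Real.sqrt a : ℂ) * autJ z := by
  have h0 := neg_I_mul_ne_zero hz
  have ha' : (a : ℂ) ≠ 0 := by exact_mod_cast ha.ne'
  rw [autJ, autJ, mul_left_comm, Real.sqrt_eq_rpow, Complex.ofReal_cpow ha.le,
    Complex.cpow_def_of_ne_zero (mul_ne_zero ha' h0), Complex.cpow_def_of_ne_zero ha',
    Complex.cpow_def_of_ne_zero h0, Complex.log_ofReal_mul ha h0, ← Complex.exp_add,
    Complex.ofReal_log ha.le]
  congr 1
  push_cast
  ring

theorem neg_one_div_im_pos {z : ℂ} (hz : 0 < z.im) : 0 < (-1 / z).im := by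
  have : z ≠ 0 := by rintro rfl; simp at hz
  rw [neg_div, one_div, Complex.neg_im, Complex.inv_im, neg_div, neg_neg]
  exact div_pos hz (Complex.normSq_pos.mpr this)

theorem autJ_mul_autJ_neg_one_div {z : ℂ} (hz : 0 < z.im) : autJ z * autJ (-1 / z) = 1 := by
  have h0 := neg_I_mul_ne_zero hz
  have hz0 : z ≠ 0 := by rintro rfl; simp at hz
  have h1 : -Complex.I * (-1 / z) = (-Complex.I * z)⁻¹ := by
    refine eq_inv_of_mul_eq_one_left ?_
    field_simp
    simp
  have h2 : (-Complex.I * z).arg ≠ Real.pi := by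
    rw [Ne, Complex.arg_eq_pi_iff]
    intro h
    have := h.1
    simp at this
    linarith
  rw [autJ, autJ, h1, Complex.inv_cpow _ _ h2, mul_inv_cancel₀]
  exact autJ_ne_zero hz

/-- The theta series of a function on `ℤ/M` is transformed under `τ ↦ -1/τ` into the theta series of
its Fourier transform. -/
theorem hasSum_theta_neg_inv {M : ℕ} [NeZero M] (φ : ZMod M → ℂ) {τ : ℂ} (hτ : 0 < τ.im) {S : ℂ}
    (hS : HasSum (fun n : ℤ => (∑ j : ZMod M, φ j * ex (-(j.val * n) / M)) *
      ex (n ^ 2 * τ / (2 * M))) S) :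
    HasSum (fun m : ℤ => φ m * ex (m ^ 2 * (-1 / τ) / (2 * M))) (autJ (τ / M) * S) := by
  have hM : (M : ℂ) ≠ 0 := by exact_mod_cast NeZero.ne M
  have hτ0 : τ ≠ 0 := by rintro rfl; simp at hτ
  have hτM : 0 < (τ / M).im := by
    rw [Complex.div_natCast_im]
    have : (0 : ℝ) < M := by exact_mod_cast NeZero.pos M
    positivity
  have hterm : ∀ (j : ZMod M) (n : ℤ), jacobiTheta₂_term n (-j.val / M) (τ / M) =
      ex (-(j.val * n) / M) * ex (n ^ 2 * τ / (2 * M)) := by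
    intro j n
    rw [jacobiTheta₂_term, ← ex_add, ex]
    congr 1
    field_simp
  have hS' : S = ∑ j : ZMod M, φ j * jacobiTheta₂ (-j.val / M) (τ / M) := by
    refine hS.unique ?_
    refine (hasSum_sum (s := Finset.univ) fun j _ =>
      (hasSum_jacobiTheta₂_term (-(j : ZMod M).val / M) hτM).mul_left (φ j)).congr_fun fun n => ?_
    rw [Finset.sum_mul]
    refine Finset.sum_congr rfl fun j _ => ?_
    rw [hterm, mul_assoc]
  rw [hS', Finset.mul_sum]
  refine hasSum_int_of_residues fun j => ?_
  have h1 : 0 < (-1 / (τ / M)).im := neg_one_div_im_pos hτM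
  have h2 := (hasSum_jacobiTheta₂_term (-j.val / M / (τ / M)) h1).mul_left
    (φ j * Complex.exp (-Real.pi * Complex.I * (-j.val / M) ^ 2 / (τ / M)))
  have h3 := jacobiTheta₂_functional_equation (-j.val / M) (τ / M)
  have h4 : autJ (τ / M) * (φ j * jacobiTheta₂ (-j.val / M) (τ / M)) =
      φ j * Complex.exp (-Real.pi * Complex.I * (-j.val / M) ^ 2 / (τ / M)) *
        jacobiTheta₂ (-j.val / M / (τ / M)) (-1 / (τ / M)) := by
    rw [h3, ← autJ]
    have := autJ_ne_zero hτM
    generalize autJ (τ / M) = u at this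
    generalize jacobiTheta₂ (-j.val / M / (τ / M)) (-1 / (τ / M)) = v
    generalize Complex.exp _ = w
    field_simp
  rw [h4]
  refine h2.congr_fun fun n => ?_
  rw [jacobiTheta₂_term, mul_assoc, ← Complex.exp_add, ex]
  have h5 : ((M * n + j.val : ℤ) : ZMod M) = j := by simp
  rw [h5]
  congr 2
  push_cast
  field_simp
  ring

/-- The even primitive character modulo `12`. -/
def chi : ZMod 12 → ℤ := ![0, 1, 0, 0, 0, -1, 0, -1, 0, 0, 0, 1]

theorem chi_mul : ∀ a b : ZMod 12, chi (a * b) = chi a * chi b := by decide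

theorem chi_six_mul_sub_one (k : ℤ) : chi ((6 * k - 1 : ℤ) : ZMod 12) = Int.negOnePow k := by
  rcases Int.even_or_odd' k with ⟨j, rfl | rfl⟩
  · rw [Int.negOnePow_even _ (by simp)]
    have : ((6 * (2 * j) - 1 : ℤ) : ZMod 12) = -1 := by
      push_cast
      rw [← mul_assoc, show (6 * 2 : ZMod 12) = 0 by decide]
      simp
    rw [this]
    decide
  · rw [Int.negOnePow_odd _ (by simp)]
    have : ((6 * (2 * j + 1) - 1 : ℤ) : ZMod 12) = 5 := by
      push_cast
      rw [mul_add, ← mul_assoc, show (6 * 2 : ZMod 12) = 0 by decide]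
      ring
    rw [this]
    decide

/-- `2η` is the theta series of the even primitive character modulo `12`. -/
theorem hasSum_two_mul_eta {z : ℂ} (hz : 0 < z.im) :
    HasSum (fun m : ℤ => (chi m : ℂ) * ex (m ^ 2 * z / 24)) (2 * ModularForm.eta z) := by
  have h := hasSum_eta hz
  have h5 : HasSum (fun n : ℤ => (chi ((6 * n + 5 : ℤ) : ZMod 12) : ℂ) *
      ex (((6 * n + 5 : ℤ) : ℂ) ^ 2 * z / 24)) (ModularForm.eta z) := by
    rw [← (Equiv.addRight (1 : ℤ)).hasSum_iff] at h
    refine h.congr_fun fun n => ?_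
    have : (6 * n + 5 : ℤ) = 6 * (n + 1) - 1 := by ring
    rw [this, chi_six_mul_sub_one]
    simp
  have h1 : HasSum (fun n : ℤ => (chi ((6 * n + 1 : ℤ) : ZMod 12) : ℂ) *
      ex (((6 * n + 1 : ℤ) : ℂ) ^ 2 * z / 24)) (ModularForm.eta z) := by
    rw [← (Equiv.neg ℤ).hasSum_iff] at h
    refine h.congr_fun fun n => ?_
    have h2 : (6 * n + 1 : ℤ) = -1 * (6 * (-n) - 1) := by ring
    rw [h2, Int.cast_mul, chi_mul, chi_six_mul_sub_one]
    have h3 : chi ((-1 : ℤ) : ZMod 12) = 1 := by decide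
    have h4 : (-1 * (6 * (-n : ℂ) - 1)) ^ 2 = (6 * (-n : ℂ) - 1) ^ 2 := by ring
    simp only [h3, one_mul, Function.comp_apply, Equiv.neg_apply]
    push_cast
    rw [h4]
  have h0 : ∀ a : ℤ, (∀ n : ZMod 12, chi (6 * n + a) = 0) →
      HasSum (fun n : ℤ => (chi ((6 * n + a : ℤ) : ZMod 12) : ℂ) *
      ex (((6 * n + a : ℤ) : ℂ) ^ 2 * z / 24)) 0 := by
    intro a ha
    refine hasSum_zero.congr_fun fun n => ?_
    have := ha n
    push_cast at this ⊢
    rw [this]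
    simp
  have h6 := hasSum_int_of_residues (M := 6)
    (f := fun m : ℤ => (chi m : ℂ) * ex (m ^ 2 * z / 24))
    (s := fun j => if j = 1 ∨ j = 5 then ModularForm.eta z else 0) (by
      intro j
      fin_cases j
      · exact h0 0 (by decide)
      · exact h1
      · simpa using! h0 2 (by decide)
      · simpa using! h0 3 (by decide)
      · simpa using! h0 4 (by decide)
      · simpa using! h5)
  have h7 : ∑ j : ZMod 6, (if j = 1 ∨ j = 5 then ModularForm.eta z else 0) =
      2 * ModularForm.eta z := by
    rw [← Finset.sum_filter, Finset.sum_const]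
    have : (Finset.univ.filter fun j : ZMod 6 => j = 1 ∨ j = 5).card = 2 := by decide
    rw [this]
    simp
  rw [← h7]
  exact h6

/-! ### Gauss sums and the transformation of eta under `τ ↦ (-1/τ + 24b)/N` -/

theorem stdAddChar_intCast (N : ℕ) [NeZero N] (j : ℤ) :
    ZMod.stdAddChar (j : ZMod N) = ex (j / N) := by
  rw [ZMod.stdAddChar_coe, ex, ← mul_div_assoc]

/-- The quadratic Gauss sum `∑_v e(c v² / N)` over `ℤ/N`. -/
noncomputable def gaussQ (N : ℕ) [NeZero N] (c : ZMod N) : ℂ :=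
  ∑ v : ZMod N, ZMod.stdAddChar (c * v ^ 2)

/-- Completion of the square, by the substitution `v ↦ v + 2b'n`. -/
theorem gaussQ_sub_linear {N : ℕ} [NeZero N] {b b' : ZMod N} (hb : 576 * b * b' = -1) (n : ZMod N) :
    ∑ v : ZMod N, ZMod.stdAddChar (144 * b * v ^ 2 - v * n) =
      ZMod.stdAddChar (b' * n ^ 2) * gaussQ N (144 * b) := by
  rw [gaussQ, Finset.mul_sum]
  refine Fintype.sum_equiv (Equiv.addRight (2 * b' * n)) _ _ fun v => ?_
  rw [← AddChar.map_add_eq_mul]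
  congr 1
  simp only [Equiv.coe_addRight]
  linear_combination (-n * v - b' * n ^ 2) * hb

/-- The quadratic Gauss sum modulo `ℓ^2` has the value `ℓ`, whatever the unit `c` is: only the
terms with `ℓ ∣ v` survive. -/
theorem gaussQ_prime_sq {ℓ : ℕ} [NeZero ℓ] [NeZero (ℓ ^ 2)] (hℓ : ℓ.Prime) (h2 : ℓ ≠ 2)
    {c : ZMod (ℓ ^ 2)} (hc : IsUnit c) : gaussQ (ℓ ^ 2) c = ℓ := by
  have hℓ0 : (ℓ : ℂ) ≠ 0 := by exact_mod_cast hℓ.ne_zero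
  have hsq : (ℓ : ZMod (ℓ ^ 2)) ^ 2 = 0 := by exact_mod_cast ZMod.natCast_self (ℓ ^ 2)
  have h2u : IsUnit (2 : ZMod (ℓ ^ 2)) := by
    have : ((2 : ℕ) : ZMod (ℓ ^ 2)) = 2 := by norm_num
    rw [← this, ZMod.isUnit_iff_coprime]
    exact Nat.Coprime.pow_right 2 ((Nat.coprime_primes Nat.prime_two hℓ).mpr h2.symm)
  have hdvd : ∀ v : ZMod (ℓ ^ 2), (ℓ : ZMod (ℓ ^ 2)) * v = 0 → ℓ ∣ v.val := by
    intro v hv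
    have h5 : ((ℓ * v.val : ℕ) : ZMod (ℓ ^ 2)) = 0 := by simpa using hv
    rw [ZMod.natCast_eq_zero_iff] at h5
    have h6 : ℓ * ℓ ∣ ℓ * v.val := by
      rw [← pow_two]
      exact h5
    exact (Nat.mul_dvd_mul_iff_left hℓ.pos).mp h6
  -- average over the translations by multiples of `ℓ`
  have h1 : ∀ t : ℕ, gaussQ (ℓ ^ 2) c = ∑ v : ZMod (ℓ ^ 2), ZMod.stdAddChar (c * v ^ 2) *
      ZMod.stdAddChar (2 * c * ((ℓ : ZMod (ℓ ^ 2)) * v)) ^ t := by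
    intro t
    refine (Fintype.sum_equiv (Equiv.addRight ((ℓ : ZMod (ℓ ^ 2)) * t)) _ _ fun v => ?_).symm
    rw [← AddChar.map_nsmul_eq_pow, ← AddChar.map_add_eq_mul]
    congr 1
    simp only [Equiv.coe_addRight, nsmul_eq_mul]
    linear_combination (-c * t ^ 2) * hsq
  have h3 : (ℓ : ℂ) * gaussQ (ℓ ^ 2) c = ∑ v : ZMod (ℓ ^ 2), ZMod.stdAddChar (c * v ^ 2) *
      ∑ t ∈ Finset.range ℓ, ZMod.stdAddChar (2 * c * ((ℓ : ZMod (ℓ ^ 2)) * v)) ^ t := by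
    simp_rw [Finset.mul_sum]
    rw [Finset.sum_comm, ← Finset.sum_congr rfl fun t _ => h1 t]
    simp
  have h4 : ∀ v : ZMod (ℓ ^ 2), ZMod.stdAddChar (c * v ^ 2) *
      ∑ t ∈ Finset.range ℓ, ZMod.stdAddChar (2 * c * ((ℓ : ZMod (ℓ ^ 2)) * v)) ^ t =
      if (ℓ : ZMod (ℓ ^ 2)) * v = 0 then (ℓ : ℂ) else 0 := by
    intro v
    split_ifs with hv
    · have hv2 : (v ^ 2 : ZMod (ℓ ^ 2)) = 0 := by
        obtain ⟨k, hk⟩ := hdvd v hv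
        rw [← ZMod.natCast_zmod_val v, hk, Nat.cast_mul, mul_pow, hsq, zero_mul]
      simp [hv, hv2]
    · have hne : ZMod.stdAddChar (2 * c * ((ℓ : ZMod (ℓ ^ 2)) * v)) ≠ 1 := by
        intro h
        apply hv
        have h6 := ZMod.injective_stdAddChar (h.trans (AddChar.map_zero_eq_one _).symm)
        exact ((h2u.mul hc).mul_right_eq_zero).mp h6
      have hpow : ZMod.stdAddChar (2 * c * ((ℓ : ZMod (ℓ ^ 2)) * v)) ^ ℓ = 1 := by
        rw [← AddChar.map_nsmul_eq_pow, nsmul_eq_mul,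
          show (ℓ : ZMod (ℓ ^ 2)) * (2 * c * (ℓ * v)) = ℓ ^ 2 * (2 * c * v) by ring, hsq]
        simp
      rw [geom_sum_eq hne, hpow]
      simp
  have h5 : (Finset.univ.filter fun v : ZMod (ℓ ^ 2) => (ℓ : ZMod (ℓ ^ 2)) * v = 0).card = ℓ := by
    have : (Finset.univ.filter fun v : ZMod (ℓ ^ 2) => (ℓ : ZMod (ℓ ^ 2)) * v = 0) =
        (Finset.range ℓ).image fun k : ℕ => ((ℓ * k : ℕ) : ZMod (ℓ ^ 2)) := by
      ext v
      simp only [Finset.mem_filter, Finset.mem_univ, true_and, Finset.mem_image, Finset.mem_range]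
      constructor
      · intro hv
        obtain ⟨k, hk⟩ := hdvd v hv
        refine ⟨k, ?_, by rw [← hk, ZMod.natCast_zmod_val]⟩
        have := ZMod.val_lt v
        rw [hk, pow_two] at this
        exact lt_of_mul_lt_mul_left this (Nat.zero_le _)
      · rintro ⟨k, _, rfl⟩
        push_cast
        rw [← mul_assoc, ← pow_two, hsq, zero_mul]
    rw [this, Finset.card_image_of_injOn, Finset.card_range]
    intro i hi j hj hij
    simp only [Finset.coe_range, Set.mem_Iio] at hi hj
    have hlt : ∀ k < ℓ, ℓ * k < ℓ ^ 2 := fun k hk => by rw [pow_two]; gcongr; exact hℓ.pos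
    have h6 := (ZMod.natCast_eq_natCast_iff' _ _ _).mp hij
    rw [Nat.mod_eq_of_lt (hlt i hi), Nat.mod_eq_of_lt (hlt j hj)] at h6
    exact Nat.eq_of_mul_eq_mul_left hℓ.pos h6
  rw [Finset.sum_congr rfl fun v _ => h4 v, ← Finset.sum_filter, Finset.sum_const, h5,
    nsmul_eq_mul] at h3
  exact mul_left_cancel₀ hℓ0 h3

/-- The character `chi` is its own Fourier transform, up to the factor `√12`. This is verified with
`ζ = (√3 + i)/2 = e(1/12)`. -/
theorem sum_chi_mul (n : ZMod 12) :
    ∑ u : ZMod 12, (chi u : ℂ) * ZMod.stdAddChar (-(u * n)) = (Real.sqrt 12 : ℂ) * chi n := by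
  obtain ⟨r, hr⟩ : ∃ r : ℂ, r = (Real.sqrt 3 : ℂ) := ⟨_, rfl⟩
  have hr2 : r ^ 2 = 3 := by
    rw [hr]
    exact_mod_cast Real.sq_sqrt (by norm_num : (0 : ℝ) ≤ 3)
  have h12 : (Real.sqrt 12 : ℂ) = 2 * r := by
    rw [hr, show (12 : ℝ) = 2 ^ 2 * 3 by norm_num, Real.sqrt_mul (by norm_num),
      Real.sqrt_sq (by norm_num)]
    push_cast
    ring
  obtain ⟨ζ, hζ⟩ : ∃ ζ : ℂ, ζ = (r + Complex.I) / 2 := ⟨_, rfl⟩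
  have hζ1 : ZMod.stdAddChar (1 : ZMod 12) = ζ := by
    have h := stdAddChar_intCast 12 1
    rw [Int.cast_one] at h
    rw [h, ex, hζ, hr]
    have : (2 * Real.pi * Complex.I * ((1 : ℤ) / (12 : ℕ)) : ℂ) =
        ((Real.pi / 6 : ℝ) : ℂ) * Complex.I := by
      push_cast
      ring
    rw [this, Complex.exp_mul_I, ← Complex.ofReal_cos, ← Complex.ofReal_sin,
      Real.cos_pi_div_six, Real.sin_pi_div_six]
    push_cast
    ring
  have hI := Complex.I_sq
  have hs : ∀ k : ZMod 12, ZMod.stdAddChar k = ζ ^ k.val := by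
    intro k
    rw [← hζ1, ← AddChar.map_nsmul_eq_pow]
    simp
  have h2 : ζ ^ 2 = (1 + r * Complex.I) / 2 := by rw [hζ]; linear_combination hr2 / 4 + hI / 4
  have h3 : ζ ^ 3 = Complex.I := by
    rw [pow_succ, h2, hζ]; linear_combination (Complex.I / 4) * hr2 + (r / 4) * hI
  have h6 : ζ ^ 6 = -1 := by rw [show 6 = 3 * 2 from rfl, pow_mul, h3, hI]
  have hp : ∀ j : ℕ, ζ ^ (6 + j) = -ζ ^ j := fun j => by rw [pow_add, h6]; ring
  have h4 : ζ ^ 4 = ζ * Complex.I := by rw [pow_succ, h3]; ring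
  have h5 : ζ ^ 5 = ζ ^ 2 * Complex.I := by rw [show 5 = 3 + 2 from rfl, pow_add, h3]; ring
  have h7 : ζ ^ 7 = -ζ := by rw [show 7 = 6 + 1 from rfl, hp, pow_one]
  have h8 : ζ ^ 8 = -ζ ^ 2 := hp 2
  have h9 : ζ ^ 9 = -ζ ^ 3 := hp 3
  have h10 : ζ ^ 10 = -ζ ^ 4 := hp 4
  have h11 : ζ ^ 11 = -ζ ^ 5 := hp 5
  have hsum : ∑ u : ZMod 12, (chi u : ℂ) * ZMod.stdAddChar (-(u * n)) =
      ζ ^ (-n).val - ζ ^ (-(5 * n)).val - ζ ^ (-(7 * n)).val + ζ ^ (-(11 * n)).val := by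
    simp_rw [hs]
    have hc : ∀ u : ZMod 12, (chi u : ℂ) * ζ ^ (-(u * n)).val =
        (if u = 1 then ζ ^ (-(u * n)).val else 0) - (if u = 5 then ζ ^ (-(u * n)).val else 0) -
        (if u = 7 then ζ ^ (-(u * n)).val else 0) + (if u = 11 then ζ ^ (-(u * n)).val else 0) := by
      have hchi : ∀ u : ZMod 12, chi u = (if u = 1 then 1 else 0) - (if u = 5 then 1 else 0) -
        (if u = 7 then 1 else 0) + (if u = 11 then 1 else 0) := by decide
      intro u
      rw [hchi]
      push_cast
      split_ifs <;> ring
    simp_rw [hc]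
    simp [Finset.sum_add_distrib, Finset.sum_sub_distrib]
  rw [hsum, h12]
  have hcase : ∀ a b c d : ℕ, ∀ e : ℤ, (-n).val = a → (-(5 * n)).val = b → (-(7 * n)).val = c →
      (-(11 * n)).val = d → chi n = e → ζ ^ a - ζ ^ b - ζ ^ c + ζ ^ d = 2 * r * e →
      ζ ^ (-n).val - ζ ^ (-(5 * n)).val - ζ ^ (-(7 * n)).val + ζ ^ (-(11 * n)).val =
        2 * r * chi n := by
    rintro a b c d e rfl rfl rfl rfl rfl h
    exact h
  have hk : ∀ n : ZMod 12, ∃ a : ℕ, a < 12 ∧ n = a := fun n =>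
    ⟨n.val, ZMod.val_lt n, (ZMod.natCast_zmod_val n).symm⟩
  obtain ⟨a, ha, rfl⟩ := hk n
  interval_cases a
  · exact hcase 0 0 0 0 0 rfl rfl rfl rfl rfl (by push_cast; ring)
  · refine hcase 11 7 5 1 1 rfl rfl rfl rfl rfl ?_
    rw [h11, h7, h5, h2, pow_one, hζ]
    push_cast
    linear_combination (-r) * hI
  · exact hcase 10 2 10 2 0 rfl rfl rfl rfl rfl (by push_cast; ring)
  · exact hcase 9 9 3 3 0 rfl rfl rfl rfl rfl (by push_cast; ring)
  · exact hcase 8 4 8 4 0 rfl rfl rfl rfl rfl (by push_cast; ring)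
  · refine hcase 7 11 1 5 (-1) rfl rfl rfl rfl rfl ?_
    rw [h11, h7, h5, h2, pow_one, hζ]
    push_cast
    linear_combination r * hI
  · exact hcase 6 6 6 6 0 rfl rfl rfl rfl rfl (by push_cast; ring)
  · refine hcase 5 1 11 7 (-1) rfl rfl rfl rfl rfl ?_
    rw [h11, h7, h5, h2, pow_one, hζ]
    push_cast
    linear_combination r * hI
  · exact hcase 4 8 4 8 0 rfl rfl rfl rfl rfl (by push_cast; ring)
  · exact hcase 3 3 9 9 0 rfl rfl rfl rfl rfl (by push_cast; ring)
  · exact hcase 2 10 2 10 0 rfl rfl rfl rfl rfl (by push_cast; ring)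
  · refine hcase 1 5 7 11 1 rfl rfl rfl rfl rfl ?_
    rw [h11, h7, h5, h2, pow_one, hζ]
    push_cast
    linear_combination (-r) * hI

/-- The function on `ℤ/12N` whose theta series is `2η((τ + 24b)/N)`. -/
noncomputable def etaCoeff (N : ℕ) [NeZero N] (b : ZMod N) (j : ZMod (12 * N)) : ℂ :=
  chi (ZMod.castHom (Dvd.intro _ rfl) (ZMod 12) j) *
    ZMod.stdAddChar (b * (ZMod.castHom (Dvd.intro_left _ rfl) (ZMod N) j) ^ 2)

/-- Every residue class modulo `12N` is `Nu + 12v` for unique `u` modulo `12` and `v` modulo `N`. -/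
theorem bijective_crt (N : ℕ) [NeZero N] (hN : N.Coprime 12) : Function.Bijective
    fun p : ZMod 12 × ZMod N => ((N * p.1.val + 12 * p.2.val : ℕ) : ZMod (12 * N)) := by
  rw [Fintype.bijective_iff_injective_and_card]
  constructor
  · rintro ⟨u, v⟩ ⟨u', v'⟩ h
    have h1 := (ZMod.natCast_eq_natCast_iff _ _ _).mp h
    have h12 : N * u.val ≡ N * u'.val [MOD 12] := by
      have := h1.of_mul_right N
      simpa [Nat.ModEq, Nat.add_mod] using this
    have hNN : 12 * v.val ≡ 12 * v'.val [MOD N] := by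
      have := h1.of_mul_left 12
      simpa [Nat.ModEq, Nat.add_mod] using this
    have hu := Nat.ModEq.cancel_left_of_coprime (by rw [Nat.gcd_comm]; exact hN) h12
    have hv := Nat.ModEq.cancel_left_of_coprime hN hNN
    rw [← ZMod.natCast_eq_natCast_iff] at hu hv
    simp only [ZMod.natCast_zmod_val] at hu hv
    rw [hu, hv]
  · simp [ZMod.card]

/-- The Fourier transform of the coefficients for `b` is a multiple of the coefficients for `b'`,
where `576bb' = -1`: it factors into the sum of `chi` over `ℤ/12` and a Gauss sum over `ℤ/N`. -/
theorem fourier_etaCoeff {N : ℕ} [NeZero N] (hN : N.Coprime 12) {b b' : ZMod N}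
    (hb : 576 * b * b' = -1) (n : ℤ) :
    ∑ j : ZMod (12 * N), etaCoeff N b j * ex (-(j.val * n) / ((12 * N : ℕ) : ℂ)) =
      Real.sqrt 12 * chi N * gaussQ N (144 * b) * etaCoeff N b' n := by
  have hN0 : (N : ℂ) ≠ 0 := by exact_mod_cast NeZero.ne N
  have h1 : ∀ j : ZMod (12 * N), ex (-(j.val * n) / ((12 * N : ℕ) : ℂ)) =
      ZMod.stdAddChar (-(j * (n : ZMod (12 * N)))) := by
    intro j
    have := stdAddChar_intCast (12 * N) (-(j.val * n))
    simp only [Int.cast_neg, Int.cast_mul, Int.cast_natCast, ZMod.natCast_zmod_val] at this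
    rw [this]
  simp_rw [h1]
  rw [← (bijective_crt N hN).sum_comp, Fintype.sum_prod_type]
  have h2 : ∀ (u : ZMod 12) (v : ZMod N),
      etaCoeff N b ((N * u.val + 12 * v.val : ℕ) : ZMod (12 * N)) *
        ZMod.stdAddChar
          (-(((N * u.val + 12 * v.val : ℕ) : ZMod (12 * N)) * (n : ZMod (12 * N)))) =
      ((chi N : ℂ) * (chi u * ZMod.stdAddChar (-(u * (n : ZMod 12))))) *
        ZMod.stdAddChar (144 * b * v ^ 2 - v * (n : ZMod N)) := by
    intro u v
    have h3 : ZMod.stdAddChar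
        (-(((N * u.val + 12 * v.val : ℕ) : ZMod (12 * N)) * (n : ZMod (12 * N)))) =
        ZMod.stdAddChar (-(u * (n : ZMod 12))) * ZMod.stdAddChar (-(v * (n : ZMod N))) := by
      have e1 := stdAddChar_intCast (12 * N) (-((N * u.val + 12 * v.val : ℕ) * n))
      have e2 := stdAddChar_intCast 12 (-(u.val * n))
      have e3 := stdAddChar_intCast N (-(v.val * n))
      simp only [Int.cast_neg, Int.cast_mul, Int.cast_natCast, ZMod.natCast_zmod_val] at e1 e2 e3
      rw [e1, e2, e3, ← ex_add]
      congr 1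
      push_cast
      field_simp
      ring
    rw [h3, sub_eq_add_neg, AddChar.map_add_eq_mul, etaCoeff]
    have h4 : ZMod.castHom (Dvd.intro N rfl) (ZMod 12)
        ((N * u.val + 12 * v.val : ℕ) : ZMod (12 * N)) = N * u := by
      rw [map_natCast]
      push_cast
      rw [show (12 : ZMod 12) = 0 by decide]
      simp
    have h5 : ZMod.castHom (Dvd.intro_left 12 rfl) (ZMod N)
        ((N * u.val + 12 * v.val : ℕ) : ZMod (12 * N)) = 12 * v := by
      rw [map_natCast]
      push_cast
      simp
    rw [h4, h5, chi_mul]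
    rw [show b * (12 * v) ^ 2 = 144 * b * v ^ 2 by ring]
    push_cast
    ring
  simp_rw [h2, ← Finset.mul_sum, gaussQ_sub_linear hb, ← Finset.sum_mul, ← Finset.mul_sum,
    sum_chi_mul, etaCoeff, map_intCast]
  ring

theorem hasSum_etaCoeff (N : ℕ) [NeZero N] (b : ℤ) {w : ℂ} (hw : 0 < w.im) :
    HasSum (fun m : ℤ => etaCoeff N b m * ex (m ^ 2 * w / (2 * (12 * N : ℕ))))
      (2 * ModularForm.eta ((w + 24 * b) / N)) := by
  have hN0 : (N : ℂ) ≠ 0 := by exact_mod_cast NeZero.ne N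
  have him : 0 < ((w + 24 * b) / N).im := by
    rw [Complex.div_natCast_im]
    have : (w + 24 * (b : ℂ)).im = w.im := by simp
    rw [this]
    have : (0 : ℝ) < N := by exact_mod_cast NeZero.pos N
    positivity
  refine (hasSum_two_mul_eta him).congr_fun fun m => ?_
  have h1 := stdAddChar_intCast N (b * m ^ 2)
  push_cast at h1
  rw [etaCoeff, map_intCast, map_intCast, h1, mul_assoc, ← ex_add]
  congr 2
  push_cast
  field_simp
  ring

/-- The behaviour of `η` under `z ↦ -1/z` at the points `(z + 24b)/N`. Its automorphy factor is
explicit, so that no general multiplier system of `η` is needed. -/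
theorem eta_neg_one_div_add {N : ℕ} [NeZero N] (hN : N.Coprime 12) {b b' : ℤ}
    (hb : (576 * b * b' : ZMod N) = -1) {z : ℂ} (hz : 0 < z.im) :
    ModularForm.eta ((-1 / z + 24 * b) / N) =
      (chi N * gaussQ N (144 * b) / Real.sqrt N) * autJ z *
        ModularForm.eta ((z + 24 * b') / N) := by
  have hNpos : (0 : ℝ) < N := by exact_mod_cast NeZero.pos N
  have h1 := hasSum_theta_neg_inv (M := 12 * N) (etaCoeff N b) hz
    (S := Real.sqrt 12 * chi N * gaussQ N (144 * b) * (2 * ModularForm.eta ((z + 24 * b') / N))) (by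
      refine ((hasSum_etaCoeff N b' hz).mul_left
        (Real.sqrt 12 * chi N * gaussQ N (144 * b) : ℂ)).congr_fun fun n => ?_
      rw [fourier_etaCoeff hN hb, mul_assoc])
  have h2 := hasSum_etaCoeff N b (neg_one_div_im_pos hz)
  have h3 := h2.unique h1
  have h4 : autJ (z / (12 * N : ℕ)) = autJ z / (Real.sqrt 12 * Real.sqrt N) := by
    have := autJ_ofReal_mul (a := 1 / (12 * N)) (by positivity) hz
    rw [Real.sqrt_div zero_le_one, Real.sqrt_mul (by norm_num), Real.sqrt_one] at this
    push_cast at this ⊢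
    rw [div_eq_mul_one_div z, mul_comm z, this]
    ring
  have h12 : (Real.sqrt 12 : ℂ) ≠ 0 := by
    exact_mod_cast (Real.sqrt_pos.mpr (by norm_num : (0 : ℝ) < 12)).ne'
  have hsN : (Real.sqrt N : ℂ) ≠ 0 := by exact_mod_cast (Real.sqrt_pos.mpr hNpos).ne'
  rw [h4] at h3
  apply mul_left_cancel₀ (two_ne_zero (α := ℂ))
  rw [h3]
  field_simp

open scoped MatrixGroups UpperHalfPlane ModularForm

/-! ### Modular forms of level one as functions on the complex plane -/

/-- The restriction of `F` to the upper half plane is a modular form of level one and weight `k`;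
the values of `F` elsewhere play no role. -/
def IsLevelOne (k : ℤ) (F : ℂ → ℂ) : Prop :=
  ∃ f : ModularForm 𝒮ℒ k, ∀ z : ℍ, F z = f z

theorem qParam_one (z : ℂ) : Function.Periodic.qParam 1 z = ex (z / 24) ^ 24 := by
  rw [ex_pow, Function.Periodic.qParam, ex]
  congr 1
  push_cast
  field_simp

theorem qParam_24 (z : ℂ) : Function.Periodic.qParam 24 z = ex (z / 24) := by
  rw [Function.Periodic.qParam, ex]
  congr 1
  push_cast
  ring

theorem hasExp_of_modularForm {k : ℤ} (f : ModularForm 𝒮ℒ k) {F : ℂ → ℂ} (h : ∀ z : ℍ, F z = f z) :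
    HasExp F (expand 24 (by norm_num) (UpperHalfPlane.qExpansion 1 f)) := by
  intro z hz
  have h1 := ModularForm.hasSum_qExpansion (f := f) one_pos one_mem_strictPeriods_SL ⟨z, hz⟩
  have h2 : F z = f ⟨z, hz⟩ := h ⟨z, hz⟩
  have hinj : Function.Injective fun n : ℕ => 24 * n := fun a b hab => by
    simp only at hab
    omega
  rw [h2, ← hinj.hasSum_iff]
  · refine h1.congr_fun fun n => ?_
    simp only [Function.comp_apply]
    rw [coeff_expand_mul, pow_mul, ← qParam_one]
  · intro n hn
    rw [coeff_expand_of_not_dvd 24 _ _ fun ⟨k, hk⟩ => hn ⟨k, hk.symm⟩, zero_mul]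

namespace IsLevelOne

variable {k : ℤ} {F : ℂ → ℂ} {φ : ℂ⟦X⟧}

theorem exists_hasExp (h : IsLevelOne k F) : ∃ φ : ℂ⟦X⟧, HasExp F φ :=
  let ⟨f, hf⟩ := h
  ⟨_, hasExp_of_modularForm f hf⟩

/-- The matrices `S` and `T` generate the modular group, and the expansion gives holomorphy and
boundedness at the cusp. -/
theorem of_hasExp (h : HasExp F φ) (hT : ∀ z : ℂ, 0 < z.im → F (z + 1) = F z)
    (hS : ∀ z : ℂ, 0 < z.im → F (-1 / z) = z ^ k * F z) : IsLevelOne k F := by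
  have hS' : (fun z : ℍ => F z) ∣[k] ModularGroup.S = fun z : ℍ => F z := by
    ext z
    have hz : (z : ℂ) ≠ 0 := UpperHalfPlane.ne_zero z
    have := hS z z.2
    rw [ModularForm.SL_slash_apply, UpperHalfPlane.modular_S_smul]
    rw [ModularGroup.denom_S]
    change F (-(z : ℂ))⁻¹ * (z : ℂ) ^ (-k) = F z
    rw [show (-(z : ℂ))⁻¹ = -1 / z by rw [← neg_inv, neg_div, one_div], this, mul_right_comm,
      ← zpow_add₀ hz]
    simp
  have hT' : (fun z : ℍ => F z) ∣[k] ModularGroup.T = fun z : ℍ => F z := by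
    ext z
    have := hT z z.2
    rw [ModularForm.SL_slash_apply, UpperHalfPlane.modular_T_smul]
    rw [ModularGroup.denom_apply]
    simp [ModularGroup.T, add_comm, this]
  have hinv := SlashInvariantForm.slash_action_generators_SL2Z hS' hT'
  have hbdd : UpperHalfPlane.IsBoundedAtImInfty fun z : ℍ => F z := by
    refine UpperHalfPlane.isBoundedAtImInfty_of_hasSum_qExpansion (h := 24)
      (c := fun n => coeff n φ) (by norm_num) fun τ => ?_
    rw [qParam_24]
    exact h τ τ.2
  refine ⟨{ toFun := fun z => F z, slash_action_eq' := ?_, holo' := ?_, bdd_at_cusps' := ?_ },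
    fun z => rfl⟩
  · rintro A ⟨A, rfl⟩
    exact hinv A
  · rw [UpperHalfPlane.mdifferentiable_iff]
    refine h.differentiableOn.congr fun z hz => ?_
    simp [UpperHalfPlane.ofComplex_apply_of_im_pos hz]
  · intro c hc
    rw [Subgroup.IsArithmetic.isCusp_iff_isCusp_SL2Z] at hc
    rw [OnePoint.isBoundedAt_iff_forall_SL2Z hc]
    intro γ _
    rw [hinv]
    exact hbdd

theorem eq_zero (h : IsLevelOne k F) (hk : k < 0) {z : ℂ} (hz : 0 < z.im) : F z = 0 := by
  obtain ⟨f, hf⟩ := h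
  have h1 := hf ⟨z, hz⟩
  rw [ModularFormClass.levelOne_neg_weight_eq_zero hk f] at h1
  exact h1

/-- A form of level one without constant term is divisible by `Δ = η^24`. -/
theorem div_eta (h : IsLevelOne k F) (hF : HasExp F φ) (h0 : coeff 0 φ = 0) :
    IsLevelOne (k - 12) fun z => F z / ModularForm.eta z ^ 24 := by
  obtain ⟨f, hf⟩ := h
  have h1 := (hasExp_of_modularForm f hf).unique hF
  have h2 : (UpperHalfPlane.qExpansion 1 f).coeff 0 = 0 := by
    rw [← h1] at h0
    simpa using h0
  refine ⟨CuspForm.discriminantEquiv (ModularForm.toCuspForm f h2), fun z => ?_⟩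
  rw [CuspForm.discriminantEquiv_apply, ModularForm.toCuspForm_apply, ← hf,
    ModularForm.discriminant]

theorem smul_div (h : IsLevelOne k F) {a b c d : ℤ} (hdet : a * d - b * c = 1) {z : ℂ}
    (hz : 0 < z.im) : F ((a * z + b) / (c * z + d)) = (c * z + d) ^ k * F z := by
  obtain ⟨f, hf⟩ := h
  let γ : SL(2, ℤ) := ⟨!![a, b; c, d], by simp [Matrix.det_fin_two, hdet]⟩
  have h1 : f (γ • (⟨z, hz⟩ : ℍ)) = UpperHalfPlane.denom γ (⟨z, hz⟩ : ℍ) ^ k * f ⟨z, hz⟩ :=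
    SlashInvariantForm.slash_action_eqn' f (MonoidHom.mem_range.mpr ⟨γ, rfl⟩) ⟨z, hz⟩
  rw [← hf, ← hf, UpperHalfPlane.coe_specialLinearGroup_apply, ModularGroup.denom_apply] at h1
  simpa [γ] using h1

theorem add_one (h : IsLevelOne k F) {z : ℂ} (hz : 0 < z.im) :
    F (z + 1) = F z := by
  simpa using h.smul_div (a := 1) (b := 1) (c := 0) (d := 1) (by norm_num) hz

theorem neg_one_div (h : IsLevelOne k F) {z : ℂ} (hz : 0 < z.im) :
    F (-1 / z) = z ^ k * F z := by
  simpa using h.smul_div (a := 0) (b := -1) (c := 1) (d := 0) (by norm_num) hz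

/-- The point `(-1/z + 24b)/N` is the image of `(z + 24b')/N` under a matrix of `SL(2, ℤ)` with
lower row `(N, -24b')`. -/
theorem neg_one_div_add (h : IsLevelOne k F) {N : ℕ} [NeZero N] {b b' : ℤ}
    (hb : (576 * b * b' : ZMod N) = -1) {z : ℂ} (hz : 0 < z.im) :
    F ((-1 / z + 24 * b) / N) = z ^ k * F ((z + 24 * b') / N) := by
  have hN : (N : ℂ) ≠ 0 := by exact_mod_cast NeZero.ne N
  have hz0 : z ≠ 0 := by rintro rfl; simp at hz
  have him : 0 < ((z + 24 * b') / N).im := by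
    rw [Complex.div_natCast_im]
    have : (z + 24 * (b' : ℂ)).im = z.im := by simp
    rw [this]
    have : (0 : ℝ) < N := by exact_mod_cast NeZero.pos N
    positivity
  have h1 : ((576 * b * b' + 1 : ℤ) : ZMod N) = 0 := by
    push_cast
    rw [hb]
    ring
  rw [ZMod.intCast_zmod_eq_zero_iff_dvd] at h1
  obtain ⟨y, hy⟩ := h1
  have hy' : (576 * b * b' + 1 : ℂ) = N * y := by exact_mod_cast hy
  have h2 := h.smul_div (a := 24 * b) (b := -y) (c := N) (d := -24 * b')
    (by linear_combination -hy) him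
  push_cast at h2
  have h3 : (N : ℂ) * ((z + 24 * b') / N) + -24 * b' = z := by
    field_simp
    ring
  rw [h3] at h2
  rw [← h2]
  congr 1
  field_simp
  linear_combination -hy'

end IsLevelOne

/-- The Eisenstein series `E₄` as a function on the complex plane. -/
noncomputable def E4 (z : ℂ) : ℂ := ModularForm.E₄ (UpperHalfPlane.ofComplex z)

theorem isLevelOne_E4 : IsLevelOne 4 E4 :=
  ⟨ModularForm.E₄, fun z => by rw [E4, UpperHalfPlane.ofComplex_apply]⟩

/-- The expansion of `E₄` as a power series in `q^{1/24}`. -/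
noncomputable def E4Series : ℤ⟦X⟧ := expand 24 (by norm_num)
  (PowerSeries.mk fun n => if n = 0 then 1 else 240 * (ArithmeticFunction.sigma 3 n : ℤ))

theorem hasExp_E4 : HasExp E4 (toC E4Series) := by
  have h := hasExp_of_modularForm ModularForm.E₄ (F := E4)
    fun z => by rw [E4, UpperHalfPlane.ofComplex_apply]
  rw [E4Series, map_expand]
  convert h using 2
  ext n
  rw [EisensteinSeries.E_qExpansion_coeff _ ⟨2, rfl⟩,
    bernoulli_eq_bernoulli'_of_ne_one (by norm_num), bernoulli'_four]
  simp only [coeff_map, coeff_mk]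
  split_ifs <;> simp
  ring

theorem coeff_zero_E4Series : coeff 0 E4Series = 1 := by
  simp [E4Series]

theorem isLevelOne_eta_pow : IsLevelOne 12 fun z => ModularForm.eta z ^ 24 :=
  ⟨⟨⟨_, CuspForm.discriminant.slash_action_eq'⟩, CuspForm.discriminant.holo',
    fun hc g hg => (CuspForm.discriminant.zero_at_cusps' hc g hg).boundedAtFilter⟩, fun _ => rfl⟩

theorem autJ_pow_24 (z : ℂ) : autJ z ^ 24 = z ^ 12 := by
  rw [show 24 = 8 * 3 from rfl, pow_mul, autJ_pow_eight, ← pow_mul]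

/-- The normalised Gauss sum occurring in the transformation of `η` is a `24`-th root of unity,
since `η^24` is a modular form for the full modular group. -/
theorem chi_mul_gaussQ_pow {N : ℕ} [NeZero N] (hN : N.Coprime 12) {b b' : ℤ}
    (hb : (576 * b * b' : ZMod N) = -1) :
    ((chi N : ℂ) * gaussQ N (144 * b)) ^ 24 = (N : ℂ) ^ 12 := by
  have hI : 0 < Complex.I.im := by simp
  have h1 := eta_neg_one_div_add hN hb hI
  have h2 := isLevelOne_eta_pow.neg_one_div_add hb hI
  rw [h1, show (12 : ℤ) = ((12 : ℕ) : ℤ) from rfl, zpow_natCast, mul_pow, mul_pow, autJ_pow_24,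
    div_pow] at h2
  have hNpos : (0 : ℝ) < N := by exact_mod_cast NeZero.pos N
  have him : 0 < ((Complex.I + 24 * b') / N).im := by
    rw [Complex.div_natCast_im]
    have : (Complex.I + 24 * (b' : ℂ)).im = 1 := by simp
    rw [this]
    positivity
  have h3 := pow_ne_zero 24 (ModularForm.eta_ne_zero him)
  have h4 : (Real.sqrt N : ℂ) ^ 24 = (N : ℂ) ^ 12 := by
    rw [show 24 = 2 * 12 from rfl, pow_mul]
    congr 1
    exact_mod_cast Real.sq_sqrt hNpos.le
  have h6 : (N : ℂ) ^ 12 ≠ 0 := pow_ne_zero _ (by exact_mod_cast NeZero.ne N)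
  have h7 := pow_ne_zero 12 Complex.I_ne_zero
  rw [h4] at h2
  have h9 := mul_right_cancel₀ h7 ((mul_right_cancel₀ h3 h2).trans (one_mul _).symm)
  exact (div_eq_one_iff_eq h6).mp h9

/-! ### The Hecke operator of index `ℓ^2` on `η^w E₄^a` -/

/-- The form `η^w E₄^a`, of weight `w/2 + 4a`. -/
noncomputable def etaE4 (w a : ℕ) (z : ℂ) : ℂ := ModularForm.eta z ^ w * E4 z ^ a

/-- The expansion of `η^w E₄^a` in `q^{1/24}`. -/
noncomputable def etaE4Series (w a : ℕ) : ℤ⟦X⟧ := etaSeries 1 ^ w * E4Series ^ a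

theorem hasExp_etaE4 (w a : ℕ) : HasExp (etaE4 w a) (toC (etaE4Series w a)) := by
  rw [etaE4Series, map_mul, map_pow, map_pow]
  exact (hasExp_eta.pow w).mul (hasExp_E4.pow a)

theorem eta_add_one (z : ℂ) : ModularForm.eta (z + 1) = ex (1 / 24) * ModularForm.eta z := by
  have h : ex (z + 1) = ex z := ex_eq_of_sub 1 (by simp)
  rw [eta_eq, eta_eq, h, add_div, ex_add]
  ring

theorem etaE4_add_one (w a : ℕ) {z : ℂ} (hz : 0 < z.im) :
    etaE4 w a (z + 1) = ex (1 / 24) ^ w * etaE4 w a z := by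
  rw [etaE4, etaE4, eta_add_one, isLevelOne_E4.add_one hz]
  ring

theorem etaE4_add_natCast (w a : ℕ) {z : ℂ} (hz : 0 < z.im) (n : ℕ) :
    etaE4 w a (z + n) = (ex (1 / 24) ^ w) ^ n * etaE4 w a z := by
  induction n with
  | zero => simp
  | succ n ih =>
    rw [Nat.cast_succ, ← add_assoc, etaE4_add_one w a (by simpa using hz), ih, pow_succ]
    ring

theorem ex_pow_24 : ex (1 / 24) ^ 24 = 1 := by
  rw [ex_pow]
  norm_num
  simpa using ex_natCast 1

theorem etaE4_neg_one_div_add (w a : ℕ) {N : ℕ} [NeZero N] (hN : N.Coprime 12) {b b' : ℤ}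
    (hb : (576 * b * b' : ZMod N) = -1) {z : ℂ} (hz : 0 < z.im) :
    etaE4 w a ((-1 / z + 24 * b) / N) = (chi N * gaussQ N (144 * b) / Real.sqrt N) ^ w *
      autJ z ^ (w + 8 * a) * etaE4 w a ((z + 24 * b') / N) := by
  have h4 := isLevelOne_E4.neg_one_div_add hb hz
  have h8 : z ^ (4 : ℤ) = autJ z ^ 8 := by
    rw [autJ_pow_eight]
    norm_cast
  rw [etaE4, etaE4, eta_neg_one_div_add hN hb hz, h4, h8]
  ring

theorem im_add_div_pos {z : ℂ} (hz : 0 < z.im) (b : ℤ) {N : ℕ} (hN : N ≠ 0) :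
    0 < ((z + 24 * b) / N).im := by
  rw [Complex.div_natCast_im]
  have : (z + 24 * (b : ℂ)).im = z.im := by simp
  rw [this]
  positivity

/-- A sum over `ℤ/ℓ^2`, split into the units and the multiples of `ℓ`. -/
theorem sum_zmod_prime_sq {ℓ : ℕ} (hℓ : ℓ.Prime) [NeZero (ℓ ^ 2)] (h : ZMod (ℓ ^ 2) → ℂ) :
    ∑ b, h b = ∑ u : (ZMod (ℓ ^ 2))ˣ, h u + ∑ c ∈ Finset.range ℓ, h ((ℓ * c : ℕ)) := by
  classical
  rw [← Finset.sum_filter_add_sum_filter_not Finset.univ fun b : ZMod (ℓ ^ 2) => IsUnit b]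
  congr 1
  · have : (Finset.univ.filter fun b : ZMod (ℓ ^ 2) => IsUnit b) =
        Finset.univ.image fun u : (ZMod (ℓ ^ 2))ˣ => (u : ZMod (ℓ ^ 2)) := by
      ext b
      simp only [Finset.mem_filter, Finset.mem_univ, true_and, Finset.mem_image]
      exact Iff.rfl
    rw [this, Finset.sum_image fun u _ v _ huv => Units.ext huv]
  · have : (Finset.univ.filter fun b : ZMod (ℓ ^ 2) => ¬IsUnit b) =
        (Finset.range ℓ).image fun c : ℕ => ((ℓ * c : ℕ) : ZMod (ℓ ^ 2)) := by
      ext b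
      simp only [Finset.mem_filter, Finset.mem_univ, true_and, Finset.mem_image, Finset.mem_range]
      have hb : IsUnit b ↔ b.val.Coprime (ℓ ^ 2) := by
        conv_lhs => rw [← ZMod.natCast_zmod_val b]
        exact ZMod.isUnit_iff_coprime _ _
      rw [hb, Nat.coprime_pow_right_iff (by norm_num), Nat.coprime_comm,
        hℓ.coprime_iff_not_dvd, not_not]
      constructor
      · rintro ⟨k, hk⟩
        refine ⟨k, ?_, by rw [← hk, ZMod.natCast_zmod_val]⟩
        have := ZMod.val_lt b
        rw [hk, pow_two] at this
        exact lt_of_mul_lt_mul_left this (Nat.zero_le _)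
      · rintro ⟨k, hk, rfl⟩
        rw [ZMod.val_natCast]
        exact (Nat.dvd_mod_iff (Dvd.intro_left ℓ (pow_two ℓ).symm)).mpr ⟨k, rfl⟩
    rw [this, Finset.sum_image]
    intro i hi j hj hij
    simp only [Finset.coe_range, Set.mem_Iio] at hi hj
    have hlt : ∀ k < ℓ, ℓ * k < ℓ ^ 2 := fun k hk => by rw [pow_two]; gcongr; exact hℓ.pos
    have h6 := (ZMod.natCast_eq_natCast_iff' _ _ _).mp hij
    rw [Nat.mod_eq_of_lt (hlt i hi), Nat.mod_eq_of_lt (hlt j hj)] at h6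
    exact Nat.eq_of_mul_eq_mul_left hℓ.pos h6

section Hecke

variable {ℓ w a : ℕ}

/-- The translate `f((z + 24b)/ℓ^2)` of `f = η^w E₄^a`. -/
noncomputable def transl (ℓ w a : ℕ) (b : ℕ) (z : ℂ) : ℂ :=
  etaE4 w a ((z + 24 * b) / (ℓ ^ 2 : ℕ))

/-- The action of `z ↦ -1/z` in weight `κ/2`. -/
noncomputable def slashS (κ : ℕ) (g : ℂ → ℂ) (z : ℂ) : ℂ := (autJ z ^ κ)⁻¹ * g (-1 / z)

theorem slashS_neg_one_div (κ : ℕ) (g : ℂ → ℂ) {z : ℂ} (hz : 0 < z.im) :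
    slashS κ g (-1 / z) = autJ z ^ κ * g z := by
  have hz0 : z ≠ 0 := by rintro rfl; simp at hz
  have h1 : -1 / (-1 / z) = z := by field_simp
  have h2 := autJ_mul_autJ_neg_one_div hz
  rw [slashS, h1, ← inv_pow, inv_eq_of_mul_eq_one_left h2]

theorem transl_add_natCast_mul (hℓ : ℓ ≠ 0) (b n : ℕ) {z : ℂ} (hz : 0 < z.im) :
    transl ℓ w a (b + ℓ ^ 2 * n) z = transl ℓ w a b z := by
  have hN : ((ℓ ^ 2 : ℕ) : ℂ) ≠ 0 := by exact_mod_cast pow_ne_zero 2 hℓ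
  have him : 0 < ((z + 24 * b) / (ℓ ^ 2 : ℕ)).im := by
    simpa using im_add_div_pos hz b (pow_ne_zero 2 hℓ)
  rw [transl, transl, show (z + 24 * ((b + ℓ ^ 2 * n : ℕ) : ℂ)) / (ℓ ^ 2 : ℕ) =
    (z + 24 * b) / (ℓ ^ 2 : ℕ) + ((24 * n : ℕ) : ℂ) by push_cast at hN ⊢; field_simp; ring,
    etaE4_add_natCast w a him, ← pow_mul, show w * (24 * n) = 24 * (w * n) by ring, pow_mul,
    ex_pow_24]
  simp

theorem transl_congr (hℓ : ℓ ≠ 0) {b c : ℕ} (h : (b : ZMod (ℓ ^ 2)) = c) {z : ℂ} (hz : 0 < z.im) :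
    transl ℓ w a b z = transl ℓ w a c z := by
  rw [ZMod.natCast_eq_natCast_iff'] at h
  rw [← Nat.mod_add_div b (ℓ ^ 2), ← Nat.mod_add_div c (ℓ ^ 2), transl_add_natCast_mul hℓ _ _ hz,
    transl_add_natCast_mul hℓ _ _ hz, h]

theorem coprime_twelve (hℓ : ℓ.Prime) (h5 : 5 ≤ ℓ) : ℓ.Coprime 12 := by
  rw [hℓ.coprime_iff_not_dvd, show 12 = 2 ^ 2 * 3 by norm_num, hℓ.dvd_mul]
  rintro (h | h)
  · have := Nat.le_of_dvd (by norm_num) (hℓ.dvd_of_dvd_pow h); omega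
  · have := Nat.le_of_dvd (by norm_num) h; omega

theorem sq_mod_24 (hℓ : ℓ.Prime) (h5 : 5 ≤ ℓ) : ∃ u, ℓ ^ 2 = 24 * u + 1 := by
  have h1 := coprime_twelve hℓ h5
  have h2 : ∀ x : ZMod 24, IsUnit x → x ^ 2 = 1 := by
    rintro _ ⟨u, rfl⟩
    revert u
    decide
  have h3 : ℓ.Coprime 24 := by
    rw [show 24 = 12 * 2 by norm_num]
    exact h1.mul_right (Nat.Coprime.coprime_dvd_right (by norm_num) h1)
  have h4 := h2 ℓ ((ZMod.isUnit_iff_coprime _ _).mpr h3)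
  have h6 : ((ℓ ^ 2 : ℕ) : ZMod 24) = (1 : ℕ) := by push_cast; exact h4
  rw [ZMod.natCast_eq_natCast_iff'] at h6
  exact ⟨ℓ ^ 2 / 24, by omega⟩

theorem chi_sq (hℓ : ℓ.Prime) (h5 : 5 ≤ ℓ) : chi ((ℓ ^ 2 : ℕ) : ZMod 12) = 1 := by
  obtain ⟨u, hu⟩ := sq_mod_24 hℓ h5
  have h : ((24 : ℕ) : ZMod 12) = 0 := by decide
  rw [hu, Nat.cast_add, Nat.cast_mul, h, zero_mul, zero_add]
  decide

theorem isUnit_natCast_of_dvd_pow {N : ℕ} (hN : N.Coprime 12) {n k : ℕ} (hn : n ∣ 12 ^ k) :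
    IsUnit ((n : ℕ) : ZMod N) := by
  rw [ZMod.isUnit_iff_coprime]
  exact (Nat.Coprime.coprime_dvd_right hn (Nat.Coprime.pow_right k hN)).symm

/-- For a unit `u`, the translates by `u` and by `-1/(576u)` are interchanged by `z ↦ -1/z`. -/
theorem transl_unit_neg_one_div (hℓ : ℓ.Prime) (h5 : 5 ≤ ℓ) [NeZero (ℓ ^ 2)] {b b' : ZMod (ℓ ^ 2)}
    (hb : 576 * b * b' = -1) {z : ℂ} (hz : 0 < z.im) :
    transl ℓ w a b.val (-1 / z) = autJ z ^ (w + 8 * a) * transl ℓ w a b'.val z := by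
  have : NeZero ℓ := ⟨hℓ.ne_zero⟩
  have hN : (ℓ ^ 2).Coprime 12 := Nat.Coprime.pow_left 2 (coprime_twelve hℓ h5)
  have h1 := etaE4_neg_one_div_add w a hN (b := b.val) (b' := b'.val) (by simpa using hb) hz
  have hu : IsUnit b := by
    refine IsUnit.of_mul_eq_one (-576 * b') ?_
    linear_combination -hb
  have h144 : IsUnit (144 : ZMod (ℓ ^ 2)) := by
    exact_mod_cast isUnit_natCast_of_dvd_pow hN (n := 144) (k := 2) (by norm_num)
  have h2 : gaussQ (ℓ ^ 2) (144 * ((b.val : ℤ) : ZMod (ℓ ^ 2))) = ℓ :=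
    gaussQ_prime_sq hℓ (by omega) (by simpa using h144.mul hu)
  have h3 : (Real.sqrt (ℓ ^ 2 : ℕ) : ℂ) = ℓ := by
    push_cast
    rw [Real.sqrt_sq (Nat.cast_nonneg _)]
    simp
  rw [h2, h3, chi_sq hℓ h5] at h1
  have hℓ0 : (ℓ : ℂ) ≠ 0 := by exact_mod_cast hℓ.ne_zero
  simpa [transl, hℓ0] using h1

/-- The term `c = 0` of the Hecke operator is a multiple of `f(ℓ^2 z)`. -/
theorem slashS_transl_zero (hℓ : ℓ ≠ 0) {z : ℂ} (hz : 0 < z.im) :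
    slashS (w + 8 * a) (transl ℓ w a 0) z =
      (ℓ : ℂ) ^ (w + 8 * a) * etaE4 w a ((ℓ ^ 2 : ℕ) * z) := by
  have hN : (0 : ℝ) < (ℓ : ℝ) ^ 2 := by positivity
  have him : 0 < (((ℓ ^ 2 : ℕ) : ℂ) * z).im := by
    have : (((ℓ ^ 2 : ℕ) : ℂ) * z).im = (ℓ : ℝ) ^ 2 * z.im := by
      rw [show ((ℓ ^ 2 : ℕ) : ℂ) = (((ℓ : ℝ) ^ 2 : ℝ) : ℂ) by push_cast; rfl, Complex.im_ofReal_mul]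
    rw [this]
    positivity
  have h1 := etaE4_neg_one_div_add w a (N := 1) (b := 0) (b' := 0) (by norm_num)
    (Subsingleton.elim _ _) him
  have h2 : gaussQ 1 (144 * ((0 : ℤ) : ZMod 1)) = 1 := by simp [gaussQ]
  have h3 : chi ((1 : ℕ) : ZMod 12) = 1 := by decide
  have h4 : autJ (((ℓ ^ 2 : ℕ) : ℂ) * z) = ℓ * autJ z := by
    have := autJ_ofReal_mul hN hz
    rw [Real.sqrt_sq (Nat.cast_nonneg _)] at this
    exact_mod_cast this
  rw [h2, h3, h4] at h1
  have h5 : (-1 / z + 24 * ((0 : ℕ) : ℂ)) / (ℓ ^ 2 : ℕ) = -1 / (((ℓ ^ 2 : ℕ) : ℂ) * z) := by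
    rw [Nat.cast_zero, mul_zero, add_zero, div_div, mul_comm z]
  have hJ := pow_ne_zero (w + 8 * a) (autJ_ne_zero hz)
  rw [slashS, transl, h5]
  simp only [Int.cast_zero, mul_zero, add_zero, Nat.cast_one, div_one, Real.sqrt_one, Int.cast_one,
    Complex.ofReal_one, mul_one, one_pow, one_mul] at h1
  rw [h1, mul_pow]
  field_simp

/-- The terms of the Hecke operator with `c` prime to `ℓ` are multiples of translates
`f(z + 24c'/ℓ)`. -/
theorem slashS_transl_mul (hℓ : ℓ.Prime) (h5 : 5 ≤ ℓ) [NeZero ℓ] {c c' : ℕ}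
    (hc : (576 * c * c' : ZMod ℓ) = -1) {z : ℂ} (hz : 0 < z.im) :
    slashS (w + 8 * a) (transl ℓ w a (ℓ * c)) z =
      (chi ℓ * gaussQ ℓ (144 * c)) ^ w * (ℓ : ℂ) ^ (4 * a) * etaE4 w a (z + 24 * c' / ℓ) := by
  have hpos : (0 : ℝ) < ℓ := by exact_mod_cast hℓ.pos
  have hℓ0 : (ℓ : ℂ) ≠ 0 := by exact_mod_cast hℓ.ne_zero
  have hz0 : z ≠ 0 := by rintro rfl; simp at hz
  have him : 0 < ((ℓ : ℂ) * z).im := by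
    have : ((ℓ : ℂ) * z).im = ℓ * z.im := by simp
    rw [this]
    positivity
  have h1 := etaE4_neg_one_div_add w a (coprime_twelve hℓ h5) (b := c) (b' := c')
    (by simpa using hc) him
  have h4 : autJ ((ℓ : ℂ) * z) = (Real.sqrt ℓ : ℂ) * autJ z := by
    exact_mod_cast autJ_ofReal_mul hpos hz
  have hs : (Real.sqrt ℓ : ℂ) ≠ 0 := by exact_mod_cast (Real.sqrt_pos.mpr hpos).ne'
  have hs2 : (Real.sqrt ℓ : ℂ) ^ 2 = ℓ := by exact_mod_cast Real.sq_sqrt hpos.le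
  have h6 : (-1 / z + 24 * ((ℓ * c : ℕ) : ℂ)) / (ℓ ^ 2 : ℕ) =
      (-1 / ((ℓ : ℂ) * z) + 24 * (c : ℤ)) / ℓ := by
    push_cast
    field_simp
  have h7 : ((ℓ : ℂ) * z + 24 * (c' : ℤ)) / ℓ = z + 24 * c' / ℓ := by
    push_cast
    field_simp
  have hJ := pow_ne_zero (w + 2 * (4 * a)) (autJ_ne_zero hz)
  rw [slashS, transl, h6, h1, h7, h4, div_pow, mul_pow (Real.sqrt ℓ : ℂ), pow_add (Real.sqrt ℓ : ℂ),
    show 8 * a = 2 * (4 * a) by ring, pow_mul (Real.sqrt ℓ : ℂ) 2, hs2]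
  have hsw := pow_ne_zero w hs
  push_cast
  field_simp

theorem exists_neg_inv_576 (hℓ : ℓ.Prime) (h5 : 5 ≤ ℓ) {c : ℕ} (hc0 : 0 < c) (hc : c < ℓ) :
    ∃ c' : ℕ, (576 * c * c' : ZMod ℓ) = -1 := by
  have : NeZero ℓ := ⟨hℓ.ne_zero⟩
  have h576 : IsUnit (576 : ZMod ℓ) := by
    exact_mod_cast isUnit_natCast_of_dvd_pow (coprime_twelve hℓ h5) (n := 576) (k := 3)
      (by norm_num)
  have hcu : IsUnit (c : ZMod ℓ) := by
    rw [ZMod.isUnit_iff_coprime, Nat.coprime_comm, hℓ.coprime_iff_not_dvd]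
    exact fun h => absurd (Nat.le_of_dvd hc0 h) (by omega)
  obtain ⟨v, hv⟩ := h576.mul hcu
  refine ⟨(-(v⁻¹ : (ZMod ℓ)ˣ) : ZMod ℓ).val, ?_⟩
  rw [← hv, ZMod.natCast_zmod_val]
  simp

/-- The Hecke operator of index `ℓ^2` applied to `f = η^w E₄^a`, as a sum over the cosets of the
matrices of determinant `ℓ^2`; it is multiplied by `ℓ^2` relative to the normalisation in which
its main term is `U_{ℓ^2} f`. -/
noncomputable def heckeSum (ℓ w a : ℕ) (z : ℂ) : ℂ :=
  ∑ b ∈ Finset.range (ℓ ^ 2), transl ℓ w a b z +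
    ∑ c ∈ Finset.range ℓ, slashS (w + 8 * a) (transl ℓ w a (ℓ * c)) z

theorem sum_range_transl [NeZero (ℓ ^ 2)] (z : ℂ) :
    ∑ b ∈ Finset.range (ℓ ^ 2), transl ℓ w a b z = ∑ b : ZMod (ℓ ^ 2), transl ℓ w a b.val z := by
  refine Finset.sum_nbij' (fun b : ℕ => (b : ZMod (ℓ ^ 2))) (fun b => b.val) ?_ ?_ ?_ ?_ ?_
  · simp
  · intro b _
    exact Finset.mem_range.mpr (ZMod.val_lt b)
  · intro b hb
    exact ZMod.val_cast_of_lt (Finset.mem_range.mp hb)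
  · intro b _
    exact ZMod.natCast_zmod_val b
  · intro b hb
    rw [ZMod.val_cast_of_lt (Finset.mem_range.mp hb)]

/-- Under `z ↦ -1/z` the unit translates are permuted, and the translates by multiples of `ℓ` are
interchanged with the second sum. -/
theorem heckeSum_neg_one_div (hℓ : ℓ.Prime) (h5 : 5 ≤ ℓ) {z : ℂ} (hz : 0 < z.im) :
    heckeSum ℓ w a (-1 / z) = autJ z ^ (w + 8 * a) * heckeSum ℓ w a z := by
  have : NeZero ℓ := ⟨hℓ.ne_zero⟩
  have : NeZero (ℓ ^ 2) := ⟨pow_ne_zero 2 hℓ.ne_zero⟩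
  have hN : (ℓ ^ 2).Coprime 12 := Nat.Coprime.pow_left 2 (coprime_twelve hℓ h5)
  have h576 : IsUnit (576 : ZMod (ℓ ^ 2)) := by
    exact_mod_cast isUnit_natCast_of_dvd_pow hN (n := 576) (k := 3) (by norm_num)
  have hform : ∀ y : ℂ, 0 < y.im → heckeSum ℓ w a y =
      ∑ u : (ZMod (ℓ ^ 2))ˣ, transl ℓ w a (u : ZMod (ℓ ^ 2)).val y +
      ∑ c ∈ Finset.range ℓ, transl ℓ w a (ℓ * c) y +
      ∑ c ∈ Finset.range ℓ, slashS (w + 8 * a) (transl ℓ w a (ℓ * c)) y := by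
    intro y hy
    rw [heckeSum, sum_range_transl, sum_zmod_prime_sq hℓ fun b => transl ℓ w a b.val y]
    congr 2
    refine Finset.sum_congr rfl fun c _ => transl_congr hℓ.ne_zero ?_ hy
    simp
  obtain ⟨v, hv⟩ := h576
  let e : (ZMod (ℓ ^ 2))ˣ ≃ (ZMod (ℓ ^ 2))ˣ := (Equiv.inv _).trans (Equiv.mulRight (-v⁻¹))
  have he : ∀ u : (ZMod (ℓ ^ 2))ˣ, (576 : ZMod (ℓ ^ 2)) * u * (e u : ZMod (ℓ ^ 2)) = -1 := by
    intro u
    rw [← hv]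
    have : v * u * e u = -1 := by
      simp only [e, Equiv.trans_apply, Equiv.inv_apply, Equiv.coe_mulRight]
      rw [mul_neg, mul_neg, mul_assoc, mul_inv_cancel_left, mul_inv_cancel]
    simpa using congr_arg Units.val this
  rw [hform _ (neg_one_div_im_pos hz), hform z hz, mul_add, mul_add]
  have h1 : ∑ u : (ZMod (ℓ ^ 2))ˣ, transl ℓ w a (u : ZMod (ℓ ^ 2)).val (-1 / z) =
      autJ z ^ (w + 8 * a) * ∑ u : (ZMod (ℓ ^ 2))ˣ, transl ℓ w a (u : ZMod (ℓ ^ 2)).val z := by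
    rw [Finset.mul_sum]
    exact Fintype.sum_equiv e _ _ fun u => transl_unit_neg_one_div hℓ h5 (he u) hz
  have h2 : ∑ c ∈ Finset.range ℓ, slashS (w + 8 * a) (transl ℓ w a (ℓ * c)) (-1 / z) =
      autJ z ^ (w + 8 * a) * ∑ c ∈ Finset.range ℓ, transl ℓ w a (ℓ * c) z := by
    rw [Finset.mul_sum]
    exact Finset.sum_congr rfl fun c _ => slashS_neg_one_div _ _ hz
  have h3 : autJ z ^ (w + 8 * a) *
      ∑ c ∈ Finset.range ℓ, slashS (w + 8 * a) (transl ℓ w a (ℓ * c)) z =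
      ∑ c ∈ Finset.range ℓ, transl ℓ w a (ℓ * c) (-1 / z) := by
    rw [Finset.mul_sum]
    refine Finset.sum_congr rfl fun c _ => ?_
    rw [slashS, mul_inv_cancel_left₀ (pow_ne_zero _ (autJ_ne_zero hz))]
  rw [h1, h2, h3]
  ring

/-- Since `ℓ^2 = 24u + 1`, the translation `z ↦ z + 1` permutes the translates of `f` through
`b ↦ b - u`, at the cost of a translation of the argument of `f` by `1`. -/
theorem heckeSum_add_one (hℓ : ℓ.Prime) (h5 : 5 ≤ ℓ) {z : ℂ} (hz : 0 < z.im) :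
    heckeSum ℓ w a (z + 1) = ex (1 / 24) ^ w * heckeSum ℓ w a z := by
  have : NeZero ℓ := ⟨hℓ.ne_zero⟩
  have : NeZero (ℓ ^ 2) := ⟨pow_ne_zero 2 hℓ.ne_zero⟩
  have hz1 : 0 < (z + 1).im := by simpa using hz
  obtain ⟨u, hu⟩ := sq_mod_24 hℓ h5
  have hN0 : ((ℓ ^ 2 : ℕ) : ℂ) ≠ 0 := by exact_mod_cast pow_ne_zero 2 hℓ.ne_zero
  have hu' : ((ℓ ^ 2 : ℕ) : ℂ) = 24 * u + 1 := by exact_mod_cast hu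
  have h1 : ∀ b : ℕ, transl ℓ w a (b + u) (z + 1) = ex (1 / 24) ^ w * transl ℓ w a b z := by
    intro b
    have him : 0 < ((z + 24 * b) / (ℓ ^ 2 : ℕ)).im := by
      simpa using im_add_div_pos hz b (pow_ne_zero 2 hℓ.ne_zero)
    rw [transl, transl, ← etaE4_add_one w a him]
    congr 1
    field_simp
    rw [hu']
    push_cast
    ring
  have h2 : ∑ b ∈ Finset.range (ℓ ^ 2), transl ℓ w a b (z + 1) =
      ex (1 / 24) ^ w * ∑ b ∈ Finset.range (ℓ ^ 2), transl ℓ w a b z := by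
    rw [sum_range_transl, sum_range_transl, Finset.mul_sum]
    refine (Fintype.sum_equiv (Equiv.addRight (u : ZMod (ℓ ^ 2))) _ _ fun b => ?_).symm
    rw [← h1]
    refine transl_congr hℓ.ne_zero ?_ hz1
    simp
  have h3 : ∀ c ∈ Finset.range ℓ, slashS (w + 8 * a) (transl ℓ w a (ℓ * c)) (z + 1) =
      ex (1 / 24) ^ w * slashS (w + 8 * a) (transl ℓ w a (ℓ * c)) z := by
    intro c hc
    rcases Nat.eq_zero_or_pos c with rfl | hc0
    · have him : 0 < (((ℓ ^ 2 : ℕ) : ℂ) * z).im := by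
        rw [show ((ℓ ^ 2 : ℕ) : ℂ) = (((ℓ : ℝ) ^ 2 : ℝ) : ℂ) by push_cast; rfl,
          Complex.im_ofReal_mul]
        have : (0 : ℝ) < ℓ := by exact_mod_cast hℓ.pos
        positivity
      rw [mul_zero, slashS_transl_zero hℓ.ne_zero hz1, slashS_transl_zero hℓ.ne_zero hz, mul_add,
        mul_one, etaE4_add_natCast w a him, hu, pow_succ (ex (1 / 24) ^ w), ← pow_mul,
        show w * (24 * u) = 24 * (w * u) by ring, pow_mul, ex_pow_24]
      ring
    · obtain ⟨c', hc'⟩ := exists_neg_inv_576 hℓ h5 hc0 (Finset.mem_range.mp hc)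
      rw [slashS_transl_mul hℓ h5 hc' hz1, slashS_transl_mul hℓ h5 hc' hz, add_right_comm,
        etaE4_add_one w a]
      · ring
      · have : (z + 24 * c' / ℓ : ℂ).im = z.im := by
          rw [Complex.add_im, Complex.div_natCast_im]
          simp
        rw [this]
        exact hz
  rw [heckeSum, heckeSum, h2, Finset.sum_congr rfl h3, ← Finset.mul_sum]
  ring

theorem isIntegral_ex (j : ℕ) {N : ℕ} (hN : N ≠ 0) : IsIntegral ℤ (ex (j / N)) := by
  refine IsIntegral.of_pow (Nat.pos_of_ne_zero hN) ?_
  rw [ex_pow, mul_div_cancel₀ _ (by exact_mod_cast hN), ex_natCast]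
  exact isIntegral_one

/-- The expansion of the Hecke operator: apart from the main term `ℓ^2 U_{ℓ^2} f` all its
coefficients are divisible by `ℓ^M` in the ring of algebraic integers, if the weight is at
least `M`: the Gauss sums modulo `ℓ` that occur are `√ℓ` times roots of unity. -/
theorem exists_hasExp_heckeSum (hℓ : ℓ.Prime) (h5 : 5 ≤ ℓ) {M : ℕ} (hM : 2 * M ≤ w + 8 * a) :
    ∃ ψ : ℂ⟦X⟧, (∀ n, IsIntegral ℤ (coeff n ψ)) ∧ HasExp (heckeSum ℓ w a)
      (((ℓ ^ 2 : ℕ) : ℂ) • opU ℂ (ℓ ^ 2) (toC (etaE4Series w a)) + (ℓ : ℂ) ^ M • ψ) := by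
  have : NeZero ℓ := ⟨hℓ.ne_zero⟩
  have hℓ0 : (ℓ : ℂ) ≠ 0 := by exact_mod_cast hℓ.ne_zero
  have hf := hasExp_etaE4 w a
  have hint : ∀ n, IsIntegral ℤ (coeff n (toC (etaE4Series w a))) := by
    intro n
    rw [coeff_map]
    exact isIntegral_algebraMap (x := coeff n (etaE4Series w a))
  have h1 : HasExp (fun z => ∑ b ∈ Finset.range (ℓ ^ 2), transl ℓ w a b z)
      (((ℓ ^ 2 : ℕ) : ℂ) • opU ℂ (ℓ ^ 2) (toC (etaE4Series w a))) :=
    hf.sum_comp_div (pow_ne_zero 2 hℓ.ne_zero)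
  have h2 : ∀ c ∈ Finset.range ℓ, ∃ ψ : ℂ⟦X⟧, (∀ n, IsIntegral ℤ (coeff n ψ)) ∧
      HasExp (slashS (w + 8 * a) (transl ℓ w a (ℓ * c))) ((ℓ : ℂ) ^ M • ψ) := by
    intro c hc
    rcases Nat.eq_zero_or_pos c with rfl | hc0
    · refine ⟨(ℓ : ℂ) ^ (w + 8 * a - M) • expand (ℓ ^ 2) (pow_ne_zero 2 hℓ.ne_zero)
        (toC (etaE4Series w a)), fun n => ?_, ?_⟩
      · rw [coeff_smul, smul_eq_mul]
        refine IsIntegral.mul (IsIntegral.pow (isIntegral_algebraMap (x := (ℓ : ℤ))) _) ?_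
        rw [coeff_expand]
        split_ifs
        · exact hint _
        · exact isIntegral_zero
      · rw [smul_smul, ← pow_add, Nat.add_sub_cancel' (by omega)]
        refine ((hf.comp_natCast_mul (pow_ne_zero 2 hℓ.ne_zero)).smul _).congr fun z hz => ?_
        rw [mul_zero, slashS_transl_zero hℓ.ne_zero hz]
    · obtain ⟨c', hc'⟩ := exists_neg_inv_576 hℓ h5 hc0 (Finset.mem_range.mp hc)
      set K : ℂ := (chi ℓ * gaussQ ℓ (144 * c)) ^ w * (ℓ : ℂ) ^ (4 * a) with hK
      have hK24 : K ^ 24 = (ℓ : ℂ) ^ (12 * (w + 8 * a)) := by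
        have := chi_mul_gaussQ_pow (coprime_twelve hℓ h5) (b := c) (b' := c') (by simpa using hc')
        rw [hK, mul_pow, ← pow_mul, mul_comm w, pow_mul]
        rw [Int.cast_natCast] at this
        rw [this]
        ring
      refine ⟨(K / (ℓ : ℂ) ^ M) • rescale (ex (24 * c' / ℓ / 24)) (toC (etaE4Series w a)),
        fun n => ?_, ?_⟩
      · -- the `24`-th power of `K / ℓ^M` is a power of `ℓ`
        rw [coeff_smul, smul_eq_mul, coeff_rescale]
        refine IsIntegral.mul ?_ (IsIntegral.mul (IsIntegral.pow ?_ _) (hint n))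
        · refine IsIntegral.of_pow (n := 24) (by norm_num) ?_
          rw [div_pow, hK24, ← pow_mul,
            ← Nat.add_sub_cancel' (show M * 24 ≤ 12 * (w + 8 * a) by omega),
            pow_add, mul_div_cancel_left₀ _ (pow_ne_zero _ hℓ0)]
          exact IsIntegral.pow (isIntegral_algebraMap (x := (ℓ : ℤ))) _
        · rw [show (24 * c' / ℓ / 24 : ℂ) = c' / ℓ by ring]
          exact isIntegral_ex c' hℓ.ne_zero
      · rw [smul_smul, mul_div_cancel₀ _ (pow_ne_zero _ hℓ0)]
        refine ((hf.comp_add (c := 24 * c' / ℓ) (by rw [Complex.div_natCast_im]; simp)).smul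
          K).congr fun z hz => ?_
        rw [slashS_transl_mul hℓ h5 hc' hz]
  choose! ψ hψ1 hψ2 using h2
  refine ⟨∑ c ∈ Finset.range ℓ, ψ c, fun n => ?_, ?_⟩
  · rw [map_sum]
    exact IsIntegral.sum _ fun c hc => hψ1 c hc n
  · rw [Finset.smul_sum]
    exact h1.add (HasExp.sum _ hψ2)

end Hecke

/-! ### Forms of level one modulo an integer -/

/-- Inverse of `η(dz)` up to the factor `X^d`: the series `X^d / η(dz)`. -/
noncomputable def etaInv (d : ℕ) (hd : d ≠ 0) : ℤ⟦X⟧ := expand (24 * d) (by omega) partitionSeries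

theorem etaSeries_mul_etaInv {d : ℕ} (hd : d ≠ 0) : etaSeries d * etaInv d hd = X ^ d := by
  rw [etaSeries_eq_expand hd, etaInv, mul_assoc, ← map_mul, eulerProduct_mul_partitionSeries,
    map_one, mul_one]

/-- Complex power series whose coefficients are algebraic integers. -/
noncomputable def intSeries : Subring ℂ⟦X⟧ :=
  (PowerSeries.map (algebraMap (integralClosure ℤ ℂ) ℂ)).range

theorem mem_intSeries {φ : ℂ⟦X⟧} : φ ∈ intSeries ↔ ∀ n, IsIntegral ℤ (coeff n φ) := by
  constructor
  · rintro ⟨ψ, rfl⟩ n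
    rw [coeff_map]
    exact (coeff n ψ).2
  · intro h
    refine ⟨PowerSeries.mk fun n => ⟨coeff n φ, h n⟩, ?_⟩
    ext n
    simp

theorem toC_mem_intSeries (f : ℤ⟦X⟧) : toC f ∈ intSeries :=
  mem_intSeries.mpr fun n => by
    rw [coeff_map]
    exact isIntegral_algebraMap (x := coeff n f)

theorem C_mem_intSeries {x : ℂ} (hx : IsIntegral ℤ x) : C x ∈ intSeries :=
  mem_intSeries.mpr fun n => by
    rw [coeff_C]
    split_ifs
    · exact hx
    · exact isIntegral_zero

/-- `φ` is congruent modulo `N` to the integer series `f`, in the ring of power series with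
algebraic integer coefficients. -/
def IsCongr (N : ℕ) (φ : ℂ⟦X⟧) (f : ℤ⟦X⟧) : Prop := ∃ ψ ∈ intSeries, φ = toC f + N * ψ

namespace IsCongr

variable {N : ℕ} {φ φ' : ℂ⟦X⟧} {f f' : ℤ⟦X⟧}

theorem add (h : IsCongr N φ f) (h' : IsCongr N φ' f') : IsCongr N (φ + φ') (f + f') := by
  obtain ⟨ψ, hψ, rfl⟩ := h
  obtain ⟨ψ', hψ', rfl⟩ := h'
  exact ⟨ψ + ψ', add_mem hψ hψ', by rw [map_add]; ring⟩

theorem mul_toC (h : IsCongr N φ f) (g : ℤ⟦X⟧) : IsCongr N (φ * toC g) (f * g) := by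
  obtain ⟨ψ, hψ, rfl⟩ := h
  exact ⟨ψ * toC g, mul_mem hψ (toC_mem_intSeries g), by rw [map_mul]; ring⟩

theorem sub (h : IsCongr N φ f) (h' : IsCongr N φ' f') : IsCongr N (φ - φ') (f - f') := by
  obtain ⟨ψ, hψ, rfl⟩ := h
  obtain ⟨ψ', hψ', rfl⟩ := h'
  exact ⟨ψ - ψ', sub_mem hψ hψ', by rw [map_sub]; ring⟩

theorem coeff_zero (h : IsCongr N φ f) : IsCongr N (C (coeff 0 φ)) (C (coeff 0 f)) := by
  obtain ⟨ψ, hψ, rfl⟩ := h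
  refine ⟨C (coeff 0 ψ), C_mem_intSeries (mem_intSeries.mp hψ 0), ?_⟩
  have : (N : ℂ⟦X⟧) = C (N : ℂ) := by simp
  rw [this, map_C, ← map_mul, ← map_add, map_add, coeff_map, coeff_C_mul]

/-- Congruences modulo `N` may be divided by powers of `η`, whose leading coefficient is `1`. -/
theorem of_mul_eta {k : ℕ} (h : IsCongr N (φ * toC (etaSeries 1 ^ k)) f) :
    ∃ g, IsCongr N φ g := by
  obtain ⟨ψ, hψ, h⟩ := h.mul_toC (etaInv 1 one_ne_zero ^ k)
  rw [mul_assoc, ← map_mul, ← mul_pow, etaSeries_mul_etaInv, pow_one, map_pow, map_X] at h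
  refine ⟨PowerSeries.mk fun n => coeff (n + k) (f * etaInv 1 one_ne_zero ^ k),
    PowerSeries.mk fun n => coeff (n + k) ψ, ?_, ?_⟩
  · exact mem_intSeries.mpr fun n => by rw [coeff_mk]; exact mem_intSeries.mp hψ _
  · ext n
    have := congr_arg (coeff (n + k)) h
    have hN : (N : ℂ⟦X⟧) = C (N : ℂ) := by simp
    rw [coeff_mul_X_pow, hN, map_add, coeff_C_mul, coeff_map] at this
    rw [this, hN, map_add, coeff_C_mul, coeff_map, coeff_mk, coeff_mk]

/-- An integer divisible by `N` in the algebraic integers is divisible by `N`. -/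
theorem dvd_coeff_sub (hN : N ≠ 0) (h : IsCongr N (toC f) f') (n : ℕ) :
    (N : ℤ) ∣ coeff n f - coeff n f' := by
  obtain ⟨ψ, hψ, h⟩ := h
  have h1 := congr_arg (coeff n) h
  have hN' : (N : ℂ⟦X⟧) = C (N : ℂ) := by simp
  rw [hN', map_add, coeff_C_mul, coeff_map, coeff_map] at h1
  have hN0 : (N : ℂ) ≠ 0 := by exact_mod_cast hN
  have hN1 : (N : ℚ) ≠ 0 := by exact_mod_cast hN
  have h2 : algebraMap ℚ ℂ (((coeff n f - coeff n f' : ℤ) : ℚ) / N) = coeff n ψ := by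
    simp only [eq_intCast] at h1
    rw [eq_ratCast]
    push_cast
    rw [h1]
    field_simp
    ring
  have h3 : IsIntegral ℤ (((coeff n f - coeff n f' : ℤ) : ℚ) / N) := by
    rw [← isIntegral_algebraMap_iff (algebraMap ℚ ℂ).injective, h2]
    exact mem_intSeries.mp hψ n
  obtain ⟨y, hy⟩ := IsIntegrallyClosed.isIntegral_iff.mp h3
  refine ⟨y, ?_⟩
  rw [eq_intCast, eq_div_iff hN1] at hy
  have : y * (N : ℤ) = coeff n f - coeff n f' := by exact_mod_cast hy
  rw [← this, mul_comm]

end IsCongr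

/-- The integral combinations of the forms `η^w E₄^a` of weight `κ/2`, where `w ≥ s`. -/
noncomputable def formSpan (κ s : ℕ) : Submodule ℤ ℤ⟦X⟧ :=
  Submodule.span ℤ {f | ∃ w a, s ≤ w ∧ w + 8 * a = κ ∧ f = etaE4Series w a}

theorem etaE4Series_mem_formSpan {κ s w a : ℕ} (hs : s ≤ w) (h : w + 8 * a = κ) :
    etaE4Series w a ∈ formSpan κ s :=
  Submodule.subset_span ⟨w, a, hs, h, rfl⟩

theorem mul_eta_mem_formSpan {κ s : ℕ} (k : ℕ) {g : ℤ⟦X⟧} (hg : g ∈ formSpan κ s) :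
    g * etaSeries 1 ^ k ∈ formSpan (κ + k) (s + k) := by
  refine Submodule.span_induction (p := fun g _ => g * etaSeries 1 ^ k ∈ formSpan (κ + k) (s + k))
    ?_ ?_ ?_ ?_ hg
  · rintro _ ⟨w, a, h1, h2, rfl⟩
    have : etaE4Series w a * etaSeries 1 ^ k = etaE4Series (w + k) a := by
      rw [etaE4Series, etaE4Series, pow_add]
      ring
    rw [this]
    exact etaE4Series_mem_formSpan (by omega) (by omega)
  · simp
  · intro x y _ _ hx hy
    rw [add_mul]
    exact add_mem hx hy
  · intro c x _ hx
    rw [smul_mul_assoc]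
    exact Submodule.smul_mem _ _ hx

theorem formSpan_mono (κ : ℕ) {s t : ℕ} (h : s ≤ t) : formSpan κ t ≤ formSpan κ s :=
  Submodule.span_mono fun _ ⟨w, a, h1, h2, h3⟩ => ⟨w, a, h.trans h1, h2, h3⟩

theorem HasExp.eq_of_div {F G : ℂ → ℂ} {φ φ' ψ : ℂ⟦X⟧} (hF : HasExp F φ) (hG : HasExp G ψ)
    (hG0 : ∀ z : ℂ, 0 < z.im → G z ≠ 0) (h : HasExp (fun z => F z / G z) φ') : φ' * ψ = φ :=
  ((h.mul hG).congr fun z hz => div_mul_cancel₀ _ (hG0 z hz)).unique hF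

/-- A form of level one and weight `4j` whose expansion is integral modulo `N` is modulo `N` an
integral combination of the `Δ^i E₄^(j - 3i)`. The coefficients are found one after the other by
subtracting a multiple of `E₄^j` and dividing by `Δ`. -/
theorem IsLevelOne.exists_isCongr_formSpan {N j : ℕ} {F : ℂ → ℂ} {φ : ℂ⟦X⟧} {f : ℤ⟦X⟧}
    (h : IsLevelOne (4 * j) F) (hF : HasExp F φ) (hf : IsCongr N φ f) :
    ∃ g ∈ formSpan (8 * j) 0, IsCongr N φ g := by
  induction j using Nat.strong_induction_on generalizing F φ f with
  | _ j ih =>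
  have hE : HasExp (fun z => E4 z ^ j) (toC (E4Series ^ j)) := by
    rw [map_pow]
    exact hasExp_E4.pow j
  have hE0 : coeff 0 (toC (E4Series ^ j)) = 1 := by
    rw [coeff_map, coeff_zero_eq_constantCoeff_apply, map_pow,
      ← coeff_zero_eq_constantCoeff_apply, coeff_zero_E4Series]
    simp
  have hEj : E4Series ^ j ∈ formSpan (8 * j) 0 := by
    have := etaE4Series_mem_formSpan (κ := 8 * j) (s := 0) (w := 0) (a := j) le_rfl (by omega)
    simpa [etaE4Series] using this
  set c := coeff 0 φ
  set c0 := coeff 0 f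
  have hc : IsCongr N (c • toC (E4Series ^ j)) (c0 • E4Series ^ j) := by
    have := hf.coeff_zero.mul_toC (E4Series ^ j)
    rwa [← smul_eq_C_mul, ← smul_eq_C_mul] at this
  have hEj0 : c0 • E4Series ^ j ∈ formSpan (8 * j) 0 := Submodule.smul_mem _ _ hEj
  have hG := hF.sub (hE.smul c)
  have hGl : IsLevelOne (4 * j) fun z => F z - c * E4 z ^ j := by
    refine .of_hasExp hG (fun z hz => ?_) fun z hz => ?_
    · rw [h.add_one hz, isLevelOne_E4.add_one hz]
    · rw [h.neg_one_div hz, isLevelOne_E4.neg_one_div hz, mul_pow, ← zpow_natCast (z ^ (4 : ℤ)),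
        ← zpow_mul]
      ring
  have hG0 : coeff 0 (φ - c • toC (E4Series ^ j)) = 0 := by
    rw [map_sub, coeff_smul, hE0]
    simp [c]
  have hη : HasExp (fun z => ModularForm.eta z ^ 24) (toC (etaSeries 1 ^ 24)) := by
    rw [map_pow]
    exact hasExp_eta.pow 24
  have hD := hGl.div_eta hG hG0
  obtain ⟨φ', hφ'⟩ := hD.exists_hasExp
  have hmul := hG.eq_of_div hη (fun z hz => pow_ne_zero _ (ModularForm.eta_ne_zero hz)) hφ'
  have hφ : φ = φ' * toC (etaSeries 1 ^ 24) + c • toC (E4Series ^ j) := by rw [hmul]; ring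
  rcases lt_or_ge j 3 with hj | hj
  · have h0 : φ' = 0 := by
      refine hφ'.unique fun z hz => ?_
      have := hD.eq_zero (by omega) hz
      simp [this, hasSum_zero]
    rw [h0, zero_mul, zero_add] at hφ
    exact ⟨_, hEj0, hφ ▸ hc⟩
  · have h1 : IsCongr N (φ' * toC (etaSeries 1 ^ 24)) (f - c0 • E4Series ^ j) := by
      rw [hmul]
      exact hf.sub hc
    obtain ⟨f', hf'⟩ := h1.of_mul_eta
    have hD' : IsLevelOne (4 * (j - 3 : ℕ)) fun z =>
        (F z - c * E4 z ^ j) / ModularForm.eta z ^ 24 := by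
      rw [show (4 * ((j - 3 : ℕ) : ℤ)) = 4 * j - 12 by omega]
      exact hD
    obtain ⟨g, hg, hg'⟩ := ih (j - 3) (by omega) hD' hφ' hf'
    refine ⟨g * etaSeries 1 ^ 24 + c0 • E4Series ^ j, add_mem ?_ hEj0, ?_⟩
    · have := mul_eta_mem_formSpan 24 hg
      rw [show 8 * (j - 3) + 24 = 8 * j by omega] at this
      exact formSpan_mono _ (Nat.zero_le _) this
    · rw [hφ]
      exact (hg'.mul_toC _).add hc

/-- Modulo `ℓ^m`, the operator `U_{ℓ^2}` preserves the span of the forms `η^w E₄^a` of a given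
weight, provided that this weight is large enough. -/
theorem exists_formSpan_opU {ℓ m w a : ℕ} (hℓ : ℓ.Prime) (h5 : 5 ≤ ℓ)
    (hw : 2 * (m + 2) ≤ w + 8 * a) : ∃ g ∈ formSpan (w + 8 * a) 0,
      reduce ℓ m (opU ℤ (ℓ ^ 2) (etaE4Series w a)) = reduce ℓ m g := by
  have hℓ0 : (ℓ : ℂ) ≠ 0 := by exact_mod_cast hℓ.ne_zero
  set u := opU ℤ (ℓ ^ 2) (etaE4Series w a) with hu
  have hopU : opU ℂ (ℓ ^ 2) (toC (etaE4Series w a)) = toC u := by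
    ext n
    simp [hu]
  suffices H : ∃ g ∈ formSpan (w + 8 * a) 0, IsCongr (ℓ ^ m) (toC u) g by
    obtain ⟨g, hg, hc⟩ := H
    refine ⟨g, hg, ?_⟩
    ext n
    have := hc.dvd_coeff_sub (pow_ne_zero m hℓ.ne_zero) n
    rw [reduce, coeff_map, coeff_map, eq_intCast, eq_intCast, ← sub_eq_zero, ← Int.cast_sub,
      ZMod.intCast_zmod_eq_zero_iff_dvd]
    exact this
  obtain ⟨ψ, hψ, hH⟩ := exists_hasExp_heckeSum (w := w) (a := a) hℓ h5 hw
  rw [hopU] at hH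
  -- multiplying by `η^(24 - w)`, exponents modulo `24`, gives a form of level one
  obtain ⟨w0, q, hw0, hwq⟩ : ∃ w0 q, w0 < 24 ∧ w = w0 + 24 * q :=
    ⟨w % 24, w / 24, Nat.mod_lt _ (by norm_num), (Nat.mod_add_div w 24).symm⟩
  set k := 24 - w0 with hk
  set j := 3 * q + a + 3 with hj
  have hD : HasExp (fun z => ModularForm.eta z ^ k * (((ℓ : ℂ) ^ 2)⁻¹ * heckeSum ℓ w a z))
      (toC (etaSeries 1 ^ k) * (toC u + ((ℓ ^ m : ℕ) : ℂ⟦X⟧) * ψ)) := by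
    rw [map_pow]
    refine (hasExp_eta.pow k).mul ?_
    convert hH.smul ((ℓ : ℂ) ^ 2)⁻¹ using 1
    rw [smul_add, smul_smul, smul_smul, pow_add, mul_comm ((ℓ : ℂ) ^ m), ← mul_assoc, Nat.cast_pow,
      Nat.cast_pow, inv_mul_cancel₀ (pow_ne_zero 2 hℓ0), one_smul, one_mul, smul_eq_C_mul ψ]
    simp
  have hDl : IsLevelOne (4 * j) fun z =>
      ModularForm.eta z ^ k * (((ℓ : ℂ) ^ 2)⁻¹ * heckeSum ℓ w a z) := by
    refine .of_hasExp hD (fun z hz => ?_) fun z hz => ?_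
    · have h24 : ex (1 / 24) ^ k * ex (1 / 24) ^ w = 1 := by
        rw [← pow_add, show k + w = 24 * (1 + q) by omega, pow_mul, ex_pow_24, one_pow]
      rw [eta_add_one, heckeSum_add_one hℓ h5 hz]
      linear_combination ModularForm.eta z ^ k * (((ℓ : ℂ) ^ 2)⁻¹ * heckeSum ℓ w a z) * h24
    · have hS := etaE4_neg_one_div_add 1 0 (N := 1) (b := 0) (b' := 0) (by norm_num)
        (Subsingleton.elim _ _) hz
      have h2 : gaussQ 1 (144 * ((0 : ℤ) : ZMod 1)) = 1 := by simp [gaussQ]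
      have h3 : chi ((1 : ℕ) : ZMod 12) = 1 := by decide
      have hS' : ModularForm.eta (-1 / z) = autJ z * ModularForm.eta z := by
        rw [h2, h3] at hS
        simpa [etaE4] using hS
      have hJ : autJ z ^ k * autJ z ^ (w + 8 * a) = z ^ (4 * (j : ℤ)) := by
        rw [← pow_add, show k + (w + 8 * a) = 8 * j by omega, pow_mul, autJ_pow_eight, ← pow_mul]
        exact_mod_cast rfl
      rw [hS', heckeSum_neg_one_div hℓ h5 hz, ← hJ]
      ring
  have hD0 : coeff 0 (toC (etaSeries 1 ^ k) * (toC u + ((ℓ ^ m : ℕ) : ℂ⟦X⟧) * ψ)) = 0 := by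
    rw [coeff_zero_eq_constantCoeff_apply, map_mul, ← coeff_zero_eq_constantCoeff_apply, coeff_map,
      coeff_zero_eq_constantCoeff_apply, map_pow, etaSeries_eq_expand one_ne_zero]
    simp [show k ≠ 0 by omega]
  have hη : HasExp (fun z => ModularForm.eta z ^ 24) (toC (etaSeries 1 ^ 24)) := by
    rw [map_pow]
    exact hasExp_eta.pow 24
  have hDη := hDl.div_eta hD hD0
  obtain ⟨φ, hφ⟩ := hDη.exists_hasExp
  have hmul := hD.eq_of_div hη (fun z hz => pow_ne_zero _ (ModularForm.eta_ne_zero hz)) hφ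
  have hη0 : toC (etaSeries 1 ^ k) ≠ 0 := by
    intro h0
    have := congr_arg toC (congr_arg (· ^ k) (etaSeries_mul_etaInv one_ne_zero))
    simp only [mul_pow, map_mul, h0, zero_mul, map_pow, map_X, pow_one] at this
    exact pow_ne_zero k X_ne_zero this.symm
  have hdiv : φ * toC (etaSeries 1 ^ w0) = toC u + ((ℓ ^ m : ℕ) : ℂ⟦X⟧) * ψ := by
    refine mul_left_cancel₀ hη0 ?_
    rw [← hmul, show 24 = w0 + k by omega, pow_add, map_mul]
    ring
  have hcongr : IsCongr (ℓ ^ m) (φ * toC (etaSeries 1 ^ w0)) u :=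
    ⟨ψ, mem_intSeries.mpr hψ, hdiv⟩
  obtain ⟨f, hf⟩ := hcongr.of_mul_eta
  have hDη' : IsLevelOne (4 * (3 * q + a : ℕ)) fun z =>
      ModularForm.eta z ^ k * (((ℓ : ℂ) ^ 2)⁻¹ * heckeSum ℓ w a z) / ModularForm.eta z ^ 24 := by
    rw [show (4 * ((3 * q + a : ℕ) : ℤ)) = 4 * j - 12 by omega]
    exact hDη
  obtain ⟨g, hg, ψ', hψ', hg'⟩ := hDη'.exists_isCongr_formSpan hφ hf
  refine ⟨g * etaSeries 1 ^ w0, ?_, ψ' * toC (etaSeries 1 ^ w0) - ψ, ?_, ?_⟩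
  · have := mul_eta_mem_formSpan w0 hg
    rw [show 8 * (3 * q + a) + w0 = w + 8 * a by omega] at this
    exact formSpan_mono _ (Nat.zero_le _) this
  · exact sub_mem (mul_mem hψ' (toC_mem_intSeries _)) (mem_intSeries.mpr hψ)
  · rw [hg'] at hdiv
    rw [map_mul]
    linear_combination -hdiv

/-! ### The span of the `η^w E₄^a` modulo `ℓ^m` -/

section FormMod

variable {ℓ m : ℕ}

theorem coeff_reduce (f : ℤ⟦X⟧) (n : ℕ) :
    coeff n (reduce ℓ m f) = ((coeff n f : ℤ) : ZMod (ℓ ^ m)) := by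
  rw [reduce, coeff_map, eq_intCast]

theorem opU_reduce (N : ℕ) (f : ℤ⟦X⟧) :
    opU (ZMod (ℓ ^ m)) N (reduce ℓ m f) = reduce ℓ m (opU ℤ N f) := by
  ext n
  rw [coeff_opU, coeff_reduce, coeff_reduce, coeff_opU]

/-- The span over `ℤ/ℓ^m` of the forms `η^w E₄^a` of weight `κ/2`, where `w ≥ s`. -/
noncomputable def formMod (ℓ m κ s : ℕ) : Submodule (ZMod (ℓ ^ m)) (ZMod (ℓ ^ m))⟦X⟧ :=
  Submodule.span _ {f | ∃ w a, s ≤ w ∧ w + 8 * a = κ ∧ f = reduce ℓ m (etaE4Series w a)}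

theorem reduce_etaE4Series_mem_formMod {κ s w a : ℕ} (hs : s ≤ w) (h : w + 8 * a = κ) :
    reduce ℓ m (etaE4Series w a) ∈ formMod ℓ m κ s :=
  Submodule.subset_span ⟨w, a, hs, h, rfl⟩

theorem reduce_mem_formMod {κ s : ℕ} {g : ℤ⟦X⟧} (hg : g ∈ formSpan κ s) :
    reduce ℓ m g ∈ formMod ℓ m κ s := by
  refine Submodule.span_induction (p := fun g _ => reduce ℓ m g ∈ formMod ℓ m κ s) ?_ ?_ ?_ ?_ hg
  · rintro _ ⟨w, a, h1, h2, rfl⟩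
    exact reduce_etaE4Series_mem_formMod h1 h2
  · rw [map_zero]
    exact zero_mem _
  · intro x y _ _ hx hy
    rw [map_add]
    exact add_mem hx hy
  · intro c x _ hx
    rw [map_zsmul]
    exact zsmul_mem hx c

theorem opU_mem_formMod (hℓ : ℓ.Prime) (h5 : 5 ≤ ℓ) {κ : ℕ} (hκ : 2 * (m + 2) ≤ κ)
    {f : (ZMod (ℓ ^ m))⟦X⟧} (hf : f ∈ formMod ℓ m κ 0) :
    opU (ZMod (ℓ ^ m)) (ℓ ^ 2) f ∈ formMod ℓ m κ 0 := by
  have : formMod ℓ m κ 0 ≤ (formMod ℓ m κ 0).comap (opU (ZMod (ℓ ^ m)) (ℓ ^ 2)) := by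
    refine Submodule.span_le.mpr ?_
    rintro _ ⟨w, a, -, rfl, rfl⟩
    obtain ⟨g, hg, hg'⟩ := exists_formSpan_opU hℓ h5 hκ
    rw [SetLike.mem_coe, Submodule.mem_comap, opU_reduce, hg']
    exact reduce_mem_formMod hg
  exact this hf

theorem finite_formMod (hℓ : ℓ ≠ 0) (κ s : ℕ) : Finite (formMod ℓ m κ s) := by
  have : NeZero (ℓ ^ m) := ⟨pow_ne_zero m hℓ⟩
  have hfin : {f | ∃ w a, s ≤ w ∧ w + 8 * a = κ ∧ f = reduce ℓ m (etaE4Series w a)}.Finite := by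
    refine ((Finset.range (κ + 1) ×ˢ Finset.range (κ + 1)).finite_toSet.image
      fun x => reduce ℓ m (etaE4Series x.1 x.2)).subset ?_
    rintro _ ⟨w, a, -, h, rfl⟩
    refine ⟨(w, a), ?_, rfl⟩
    simp only [Finset.coe_product, Finset.coe_range, Set.mem_prod, Set.mem_Iio]
    omega
  have : Module.Finite (ZMod (ℓ ^ m)) (formMod ℓ m κ s) := Module.Finite.span_of_finite _ hfin
  exact Module.finite_of_finite (ZMod (ℓ ^ m))

theorem etaE4Series_eq (w a : ℕ) : ∃ u : ℤ⟦X⟧, coeff 0 u = 1 ∧ etaE4Series w a = X ^ w * u := by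
  refine ⟨expand (24 * 1) (by norm_num) eulerProduct ^ w * E4Series ^ a, ?_, ?_⟩
  · have h1 := coeff_zero_E4Series
    rw [coeff_zero_eq_constantCoeff_apply] at h1
    simp [h1, constantCoeff_eulerProduct]
  · rw [etaE4Series, etaSeries_eq_expand one_ne_zero]
    ring

theorem X_pow_dvd_of_mem_formMod {κ s : ℕ} {f : (ZMod (ℓ ^ m))⟦X⟧} (hf : f ∈ formMod ℓ m κ s) :
    X ^ s ∣ f := by
  refine Submodule.span_induction (p := fun f _ => X ^ s ∣ f) ?_ (dvd_zero _)
    (fun x y _ _ hx hy => dvd_add hx hy) (fun c x _ hx => hx.trans ?_) hf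
  · rintro _ ⟨w, a, h1, -, rfl⟩
    obtain ⟨u, -, hu⟩ := etaE4Series_eq w a
    rw [hu, map_mul, map_pow, reduce, map_X]
    exact (pow_dvd_pow X h1).mul_right _
  · rw [smul_eq_C_mul]
    exact dvd_mul_left _ _

/-- The generators `η^w E₄^a = X^w + ⋯` are in echelon form, so that a combination divisible by
`X^t` involves only those with `w ≥ t`. -/
theorem mem_formMod_of_X_pow_dvd {κ t : ℕ} {f : (ZMod (ℓ ^ m))⟦X⟧} (hf : f ∈ formMod ℓ m κ 0)
    (ht : X ^ t ∣ f) : f ∈ formMod ℓ m κ t := by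
  induction t with
  | zero => exact hf
  | succ t ih =>
    have h := ih ((pow_dvd_pow X t.le_succ).trans ht)
    -- there is at most one generator with `w = t`
    have hsplit : ∀ f ∈ formMod ℓ m κ t, f ∈ formMod ℓ m κ (t + 1) ∨ ∃ a, t + 8 * a = κ ∧
        ∃ c : ZMod (ℓ ^ m), f - c • reduce ℓ m (etaE4Series t a) ∈ formMod ℓ m κ (t + 1) := by
      by_cases hex : ∃ a, t + 8 * a = κ
      · obtain ⟨a, ha⟩ := hex
        intro f hf
        refine Or.inr ⟨a, ha, ?_⟩
        refine Submodule.span_induction (p := fun f _ => ∃ c : ZMod (ℓ ^ m),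
          f - c • reduce ℓ m (etaE4Series t a) ∈ formMod ℓ m κ (t + 1)) ?_ ?_ ?_ ?_ hf
        · rintro _ ⟨w, a', h1, h2, rfl⟩
          rcases h1.eq_or_lt with rfl | h1
          · obtain rfl : a' = a := by omega
            exact ⟨1, by simp⟩
          · exact ⟨0, by simpa using reduce_etaE4Series_mem_formMod h1 h2⟩
        · exact ⟨0, by simp⟩
        · rintro x y _ _ ⟨c, hc⟩ ⟨d, hd⟩
          refine ⟨c + d, ?_⟩
          rw [add_smul, add_sub_add_comm]
          exact add_mem hc hd
        · rintro d x _ ⟨c, hc⟩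
          refine ⟨d * c, ?_⟩
          rw [mul_smul, ← smul_sub]
          exact Submodule.smul_mem _ _ hc
      · intro f hf
        refine Or.inl ?_
        have : formMod ℓ m κ t ≤ formMod ℓ m κ (t + 1) := by
          refine Submodule.span_mono ?_
          rintro _ ⟨w, a, h1, h2, rfl⟩
          rcases h1.eq_or_lt with rfl | h1
          · exact absurd ⟨a, h2⟩ hex
          · exact ⟨w, a, h1, h2, rfl⟩
        exact this hf
    rcases hsplit f h with h' | ⟨a, -, c, hc⟩
    · exact h'
    · obtain ⟨u, hu0, hu⟩ := etaE4Series_eq t a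
      have h1 := X_pow_dvd_iff.mp (X_pow_dvd_of_mem_formMod hc) t t.lt_succ_self
      have h2 := X_pow_dvd_iff.mp ht t t.lt_succ_self
      have h3 : coeff t (reduce ℓ m (etaE4Series t a)) = 1 := by
        have := coeff_X_pow_mul u t 0
        rw [zero_add] at this
        rw [coeff_reduce, hu, this, hu0, Int.cast_one]
      rw [map_sub, coeff_smul, h2, h3, zero_sub, neg_eq_zero, smul_eq_mul, mul_one] at h1
      rwa [h1, zero_smul, sub_zero] at hc

theorem exists_eq_eta_mul {κ t : ℕ} {f : (ZMod (ℓ ^ m))⟦X⟧} (hf : f ∈ formMod ℓ m (κ + t) t) :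
    ∃ g ∈ formMod ℓ m κ 0, f = reduce ℓ m (etaSeries 1 ^ t) * g := by
  refine Submodule.span_induction (p := fun f _ => ∃ g ∈ formMod ℓ m κ 0,
    f = reduce ℓ m (etaSeries 1 ^ t) * g) ?_ ⟨0, zero_mem _, by simp⟩ ?_ ?_ hf
  · rintro _ ⟨w, a, h1, h2, rfl⟩
    obtain ⟨v, rfl⟩ := Nat.exists_eq_add_of_le h1
    refine ⟨_, reduce_etaE4Series_mem_formMod (w := v) (a := a) (Nat.zero_le _) (by omega), ?_⟩
    rw [← map_mul, etaE4Series, etaE4Series]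
    congr 1
    ring
  · rintro x y _ _ ⟨g, hg, rfl⟩ ⟨g', hg', rfl⟩
    exact ⟨g + g', add_mem hg hg', by rw [mul_add]⟩
  · rintro c x _ ⟨g, hg, rfl⟩
    exact ⟨c • g, Submodule.smul_mem _ _ hg, by rw [mul_smul_comm]⟩

theorem mul_etaSeries_injective {d : ℕ} (hd : d ≠ 0) (k : ℕ) :
    Function.Injective fun f => reduce ℓ m (etaSeries d ^ k) * f := by
  intro f g h
  have h1 : reduce ℓ m (etaInv d hd ^ k) * reduce ℓ m (etaSeries d ^ k) = X ^ (d * k) := by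
    rw [← map_mul, ← mul_pow, mul_comm (etaInv d hd), etaSeries_mul_etaInv, ← pow_mul, map_pow,
      reduce, map_X]
  have h2 : X ^ (d * k) * f = X ^ (d * k) * g := by
    rw [← h1, mul_assoc, mul_assoc]
    exact congr_arg _ h
  ext n
  have h3 := congr_arg (coeff (n + d * k)) h2
  rwa [coeff_X_pow_mul, coeff_X_pow_mul] at h3

/-! ### The series `P_ℓ(r, b)` -/

/-- The coefficients of `P_ℓ(r, b)` are those of `1/η^r` in the progression `ℓ^b n`, where `1/η^r`
is shifted by `X^r`. -/
theorem coeff_PSeries (r b n : ℕ) :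
    coeff n (PSeries ℓ r b) = coeff (ℓ ^ b * n + r) (etaInv 1 one_ne_zero ^ r) := by
  rw [etaInv, ← map_pow, PSeries, coeff_mk]
  have h : ∀ N : ℕ, pPow r ((N : ℚ) / 24) =
      coeff N (expand (24 * 1) (by norm_num) (partitionSeries ^ r)) := by
    intro N
    by_cases hN : 24 ∣ N
    · obtain ⟨k, rfl⟩ := hN
      rw [show 24 * k = 24 * 1 * k by ring, coeff_expand_mul, ← pPow_natCast]
      congr 1
      push_cast
      ring
    · rw [pPow_natCast_div_of_not_dvd r N hN, coeff_expand_of_not_dvd _ _ _ (by simpa using hN)]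
  rw [← h]
  push_cast
  rfl

theorem opU_PSeries (r b : ℕ) : opU ℤ ℓ (PSeries ℓ r b) = PSeries ℓ r (b + 1) := by
  ext n
  rw [coeff_opU, coeff_PSeries, coeff_PSeries, pow_succ, mul_assoc]

theorem opU_opU {R : Type*} [CommSemiring R] (M N : ℕ) (f : R⟦X⟧) :
    opU R M (opU R N f) = opU R (N * M) f := by
  ext n
  rw [coeff_opU, coeff_opU, coeff_opU, mul_assoc]

/-- The operator `U_N` commutes with multiplication by series in `X^N`; here the indices are shifted
by `r < N`. -/
theorem coeff_expand_mul_add {N r : ℕ} (hN : N ≠ 0) (hr : r < N) (f g : ℤ⟦X⟧) (n : ℕ) :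
    coeff (N * n + r) (expand N hN f * g) =
      coeff n (f * PowerSeries.mk fun k => coeff (N * k + r) g) := by
  rw [coeff_mul, coeff_mul]
  symm
  refine Finset.sum_of_injOn (fun x : ℕ × ℕ => (N * x.1, N * x.2 + r)) ?_ ?_ ?_ ?_
  · rintro ⟨a, b⟩ - ⟨c, d⟩ - h
    simp only [Prod.mk.injEq, Nat.add_right_cancel_iff] at h
    exact Prod.ext (Nat.eq_of_mul_eq_mul_left (Nat.pos_of_ne_zero hN) h.1)
      (Nat.eq_of_mul_eq_mul_left (Nat.pos_of_ne_zero hN) h.2)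
  · rintro ⟨a, b⟩ h
    simp only [Finset.mem_coe, Finset.HasAntidiagonal.mem_antidiagonal] at h ⊢
    rw [← h]
    ring
  · rintro ⟨a, b⟩ h h'
    rw [Finset.HasAntidiagonal.mem_antidiagonal] at h
    by_cases hd : N ∣ a
    · obtain ⟨k, rfl⟩ := hd
      simp only at h
      refine absurd ⟨(k, n - k), ?_, ?_⟩ h'
      · have : k ≤ n := by
          by_contra hk
          have : N * (n + 1) ≤ N * k := Nat.mul_le_mul_left N (by omega)
          rw [mul_add] at this
          omega
        simp [this]
      · have hk : k ≤ n := by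
          by_contra hk
          have : N * (n + 1) ≤ N * k := Nat.mul_le_mul_left N (by omega)
          rw [mul_add] at this
          omega
        simp only [Prod.mk.injEq, true_and]
        obtain ⟨e, rfl⟩ := Nat.exists_eq_add_of_le hk
        rw [Nat.add_sub_cancel_left]
        rw [mul_add] at h
        omega
    · simp only
      rw [coeff_expand_of_not_dvd _ _ _ hd, zero_mul]
  · rintro ⟨a, b⟩ -
    simp only
    rw [coeff_expand_mul, coeff_mk]

theorem natCast_dvd_of_coeff {N : ℕ} {f : ℤ⟦X⟧} (h : ∀ n, (N : ℤ) ∣ coeff n f) :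
    (N : ℤ⟦X⟧) ∣ f := by
  choose c hc using h
  refine ⟨PowerSeries.mk c, ?_⟩
  ext n
  rw [show (N : ℤ⟦X⟧) = C (N : ℤ) by simp, coeff_C_mul, coeff_mk, hc]

theorem reduce_eq_of_dvd {f g : ℤ⟦X⟧} (h : (ℓ : ℤ⟦X⟧) ^ m ∣ f - g) :
    reduce ℓ m f = reduce ℓ m g := by
  obtain ⟨k, hk⟩ := h
  have h0 : reduce ℓ m ((ℓ : ℤ⟦X⟧) ^ m) = 0 := by
    rw [← Nat.cast_pow, map_natCast, ← map_natCast (C (R := ZMod (ℓ ^ m))), ZMod.natCast_self,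
      map_zero]
  rw [← sub_eq_zero, ← map_sub, hk, map_mul, h0, zero_mul]

/-- The congruence `f(X)^(ℓ^k) ≡ f(X^(ℓ^k))` modulo `ℓ`. -/
theorem natCast_dvd_pow_sub_expand (hℓ : ℓ.Prime) (f : ℤ⟦X⟧) (k : ℕ) :
    (ℓ : ℤ⟦X⟧) ∣ f ^ ℓ ^ k - expand (ℓ ^ k) (pow_ne_zero k hℓ.ne_zero) f := by
  have := Fact.mk hℓ
  have h1 : ∀ g : (ZMod ℓ)⟦X⟧, expand (ℓ ^ k) (pow_ne_zero k hℓ.ne_zero) g = g ^ ℓ ^ k := by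
    intro g
    have hid : iterateFrobenius (ZMod ℓ) ℓ k = RingHom.id _ := by
      ext x
      simp [iterateFrobenius_def, ZMod.pow_card_pow]
    have := MvPowerSeries.map_iterateFrobenius_expand ℓ hℓ.ne_zero g k
    rw [hid, MvPowerSeries.map_id] at this
    exact this
  refine natCast_dvd_of_coeff fun n => ?_
  rw [← ZMod.intCast_zmod_eq_zero_iff_dvd, ← eq_intCast (Int.castRingHom (ZMod ℓ)), ← coeff_map,
    map_sub, map_pow, map_expand, h1, sub_self, map_zero]

/-- Modulo `ℓ^m`, the form `η^(ℓ^(m+1) - r)` is mapped by `U_{ℓ^2}` to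
`η^(ℓ^(m-1)) P_ℓ(r, 2)`. -/
theorem opU_etaSeries_pow (hℓ : ℓ.Prime) {r : ℕ} (hr : r < ℓ) (hm : 1 ≤ m) :
    opU (ZMod (ℓ ^ m)) (ℓ ^ 2) (reduce ℓ m (etaSeries 1 ^ (ℓ ^ (m + 1) - r))) =
      reduce ℓ m (etaSeries 1 ^ ℓ ^ (m - 1) * PSeries ℓ r 2) := by
  obtain ⟨k, rfl⟩ : ∃ k, m = k + 1 := ⟨m - 1, by omega⟩
  have hN := pow_ne_zero 2 hℓ.ne_zero
  have hrl : r ≤ ℓ ^ (k + 1 + 1) := hr.le.trans (Nat.le_self_pow (by omega) ℓ)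
  have hr2 : r < ℓ ^ 2 := hr.trans_le (Nat.le_self_pow (by omega) ℓ)
  have h1 : etaSeries 1 ^ (ℓ ^ (k + 1 + 1) - r) * X ^ r =
      etaSeries 1 ^ ℓ ^ (k + 1 + 1) * etaInv 1 one_ne_zero ^ r := by
    have h2 : etaSeries 1 ^ ℓ ^ (k + 1 + 1) =
        etaSeries 1 ^ (ℓ ^ (k + 1 + 1) - r) * etaSeries 1 ^ r := by
      rw [← pow_add, Nat.sub_add_cancel hrl]
    rw [h2, mul_assoc, ← mul_pow, etaSeries_mul_etaInv, pow_one]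
  have h2 : reduce ℓ (k + 1) (etaSeries 1 ^ ℓ ^ (k + 1 + 1)) =
      reduce ℓ (k + 1) (expand (ℓ ^ 2) hN (etaSeries 1 ^ ℓ ^ k)) := by
    refine reduce_eq_of_dvd ?_
    rw [map_pow, show ℓ ^ (k + 1 + 1) = ℓ ^ 2 * ℓ ^ k by ring, pow_mul]
    exact dvd_sub_pow_of_dvd_sub (natCast_dvd_pow_sub_expand hℓ _ 2) k
  have h3 : reduce ℓ (k + 1) (etaSeries 1 ^ (ℓ ^ (k + 1 + 1) - r) * X ^ r) =
      reduce ℓ (k + 1) (expand (ℓ ^ 2) hN (etaSeries 1 ^ ℓ ^ k) * etaInv 1 one_ne_zero ^ r) := by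
    rw [h1, map_mul, h2, ← map_mul]
  ext n
  have h4 := congr_arg (coeff (ℓ ^ 2 * n + r)) h3
  rw [coeff_reduce, coeff_reduce, coeff_mul_X_pow, coeff_expand_mul_add hN hr2] at h4
  have h5 : (PowerSeries.mk fun k => coeff (ℓ ^ 2 * k + r) (etaInv 1 one_ne_zero ^ r)) =
      PSeries ℓ r 2 := by
    ext i
    rw [coeff_mk, coeff_PSeries]
  rw [coeff_opU, coeff_reduce, h4, h5, coeff_reduce, Nat.add_sub_cancel]

/-- Modulo `ℓ^m` the series `P_ℓ(r, 2j + 2)` all lie in the span of the forms `η^w E₄^a` of a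
fixed weight. -/
theorem exists_forall_reduce_PSeries_mem {r : ℕ} (hℓ : ℓ.Prime) (hr : r + 5 ≤ ℓ) (hm : 1 ≤ m) :
    ∃ κ, ∀ j, reduce ℓ m (PSeries ℓ r (2 * j + 2)) ∈ formMod ℓ m κ 0 := by
  have h7 : 5 ≤ ℓ := by omega
  set t := ℓ ^ (m - 1) with ht
  have htm : m ≤ t := by
    have := Nat.lt_pow_self (n := m - 1) hℓ.one_lt
    omega
  have hpow : ℓ ^ (m + 1) = ℓ ^ 2 * t := by
    rw [ht, ← pow_add]
    congr 1
    omega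
  have hbound : 2 * (m + 2) + r + t ≤ ℓ ^ (m + 1) := by
    have h1 : 5 * t ≤ ℓ * t := Nat.mul_le_mul_right t h7
    have h2 : 5 * (ℓ * t) ≤ ℓ * (ℓ * t) := Nat.mul_le_mul_right _ h7
    have h3 : ℓ * 1 ≤ ℓ * t := Nat.mul_le_mul_left ℓ (hm.trans htm)
    rw [hpow, pow_two, mul_assoc]
    omega
  obtain ⟨κ, hκ⟩ := Nat.exists_eq_add_of_le hbound
  refine ⟨2 * (m + 2) + κ, fun j => ?_⟩
  induction j with
  | zero =>
    -- divide `U_{ℓ^2} η^(ℓ^(m+1) - r)` by `η^t`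
    have hw : ℓ ^ (m + 1) - r = 2 * (m + 2) + κ + t := by omega
    have h1 : reduce ℓ m (etaSeries 1 ^ (ℓ ^ (m + 1) - r)) ∈
        formMod ℓ m (2 * (m + 2) + κ + t) 0 := by
      have := reduce_etaE4Series_mem_formMod (ℓ := ℓ) (m := m) (a := 0) (Nat.zero_le _)
        (hw ▸ rfl : ℓ ^ (m + 1) - r + 8 * 0 = 2 * (m + 2) + κ + t)
      simpa [etaE4Series] using this
    have h2 := opU_mem_formMod hℓ h7 (by omega) h1
    rw [opU_etaSeries_pow hℓ (by omega) hm, ← ht] at h2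
    have h3 : X ^ t ∣ reduce ℓ m (etaSeries 1 ^ t * PSeries ℓ r 2) := by
      obtain ⟨u, -, hu⟩ := etaE4Series_eq t 0
      rw [etaE4Series, pow_zero, mul_one] at hu
      rw [hu, mul_assoc, map_mul, map_pow, reduce, map_X]
      exact dvd_mul_right _ _
    obtain ⟨g, hg, hg'⟩ := exists_eq_eta_mul (mem_formMod_of_X_pow_dvd h2 h3)
    rw [map_mul] at hg'
    have := mul_etaSeries_injective one_ne_zero t hg'
    rwa [this]
  | succ j ih =>
    have := opU_mem_formMod hℓ h7 (by omega) ih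
    rwa [opU_reduce, show ℓ ^ 2 = ℓ * ℓ from pow_two ℓ, ← opU_opU, opU_PSeries, opU_PSeries] at this

end FormMod

/-! ### Orbits of an endomorphism and cyclic modules -/

section Orbit

variable {R M : Type*} [CommRing R] [AddCommGroup M] [Module R M]

/-- The span of the `u (b + 2j)` for `j ≥ 0`. -/
def stepSpan (R : Type*) {M : Type*} [CommRing R] [AddCommGroup M] [Module R M] (u : ℕ → M)
    (b : ℕ) : Submodule R M :=
  Submodule.span R (Set.range fun j => u (b + 2 * j))

theorem mem_stepSpan (u : ℕ → M) (b : ℕ) : u b ∈ stepSpan R u b :=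
  Submodule.subset_span ⟨0, rfl⟩

theorem stepSpan_add_le (u : ℕ → M) (b j : ℕ) : stepSpan R u (b + 2 * j) ≤ stepSpan R u b := by
  refine Submodule.span_mono ?_
  rintro _ ⟨i, rfl⟩
  exact ⟨j + i, by simp only; congr 1; ring⟩

theorem map_stepSpan {u : ℕ → M} {T : M →ₗ[R] M} (hT : ∀ b, T (u b) = u (b + 1)) (b : ℕ) :
    (stepSpan R u b).map T = stepSpan R u (b + 1) := by
  rw [stepSpan, stepSpan, Submodule.map_span, ← Set.range_comp]
  congr 2
  ext j
  rw [Function.comp_apply, hT]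
  congr 1
  ring

/-- If the span of the orbit is cyclic with generator `g` and `u b = c g`, then the whole orbit is
contained in `c • span {g}`, so that `u b` is a generator itself. -/
theorem stepSpan_eq_span_singleton {u : ℕ → M} {T : M →ₗ[R] M} (hT : ∀ b, T (u b) = u (b + 1))
    {b : ℕ} {g : M} (hg : stepSpan R u b = Submodule.span R {g}) :
    stepSpan R u b = Submodule.span R {u b} := by
  refine le_antisymm ?_ ((Submodule.span_singleton_le_iff_mem _ _).mpr (mem_stepSpan u b))
  obtain ⟨c, hc⟩ := Submodule.mem_span_singleton.mp (hg ▸ mem_stepSpan u b)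
  have hstep : ∀ x ∈ stepSpan R u b, T (T x) ∈ stepSpan R u b := by
    intro x hx
    have h1 := Submodule.mem_map_of_mem (f := T) (Submodule.mem_map_of_mem (f := T) hx)
    rw [map_stepSpan hT, map_stepSpan hT] at h1
    exact stepSpan_add_le u b 1 h1
  have hu : ∀ j, ∃ x ∈ stepSpan R u b, u (b + 2 * j) = c • x := by
    intro j
    induction j with
    | zero => exact ⟨g, hg ▸ Submodule.mem_span_singleton_self g, hc.symm⟩
    | succ j ih =>
      obtain ⟨x, hx, hj⟩ := ih
      refine ⟨T (T x), hstep x hx, ?_⟩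
      rw [← map_smul, ← map_smul, ← hj, hT, hT]
      congr 1
  refine Submodule.span_le.mpr ?_
  rintro _ ⟨j, rfl⟩
  obtain ⟨x, hx, hj⟩ := hu j
  rw [hg] at hx
  obtain ⟨d, rfl⟩ := Submodule.mem_span_singleton.mp hx
  refine Submodule.mem_span_singleton.mpr ⟨d, ?_⟩
  simp only
  rw [hj, ← hc, smul_comm]

/-- The sequence is constant from an index on where the cardinality of its terms is least. -/
theorem exists_forall_ge_eq_of_antitone {S : ℕ → Submodule R M} (hS : Antitone S) {k : ℕ}
    (hk : Finite (S k)) : ∃ n, ∀ i, n ≤ i → S i = S n := by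
  have hfin : ∀ i, k ≤ i → (S i : Set M).Finite := fun i hi =>
    Set.Finite.subset (Set.toFinite (S k : Set M)) (hS hi)
  obtain ⟨n, hn, hmin⟩ := WellFounded.has_min (measure fun i => (S i : Set M).ncard).wf
    {i | k ≤ i} ⟨k, le_refl k⟩
  refine ⟨n, fun i hi => SetLike.coe_injective ?_⟩
  exact Set.eq_of_subset_of_ncard_le (hS hi) (not_lt.mp (hmin i (le_trans hn hi))) (hfin n hn)

theorem exists_eq_span_singleton_of_spanRank_le_one {N : Submodule R M} (h : N.spanRank ≤ 1) :
    ∃ g, N = Submodule.span R {g} := by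
  obtain ⟨s, hs, rfl⟩ := N.exists_span_set_card_eq_spanRank
  rw [← hs, Cardinal.mk_le_one_iff_set_subsingleton] at h
  rcases h.eq_empty_or_singleton with rfl | ⟨g, rfl⟩
  · exact ⟨0, by simp⟩
  · exact ⟨g, rfl⟩

end Orbit

/-! ### The modules `Λ_ℓ^odd` and `Λ_ℓ^even` -/

section Lambda

variable (ℓ r m : ℕ)

/-- The reductions modulo `ℓ^m` of the series `P_ℓ(r, b)`. -/
noncomputable def redP (b : ℕ) : (ZMod (ℓ ^ m))⟦X⟧ := reduce ℓ m (PSeries ℓ r b)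

theorem opU_redP (b : ℕ) : opU (ZMod (ℓ ^ m)) ℓ (redP ℓ r m b) = redP ℓ r m (b + 1) := by
  rw [redP, opU_reduce, opU_PSeries, redP]

/-- Multiplication by `η(dz)^r` on power series modulo `ℓ^m`. -/
noncomputable def mulEta (d : ℕ) :
    (ZMod (ℓ ^ m))⟦X⟧ →ₗ[ZMod (ℓ ^ m)] (ZMod (ℓ ^ m))⟦X⟧ :=
  LinearMap.mulLeft _ (reduce ℓ m (etaSeries d ^ r))

variable {ℓ} in
theorem map_mulEta_injective {d : ℕ} (hd : d ≠ 0) :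
    Function.Injective (Submodule.map (mulEta ℓ r m d)) :=
  Submodule.map_injective_of_injective (mul_etaSeries_injective hd r)

theorem LambdaOdd_eq (b : ℕ) : LambdaOdd ℓ r (2 * b + 1) m =
    (stepSpan (ZMod (ℓ ^ m)) (redP ℓ r m) (2 * b + 1)).map (mulEta ℓ r m ℓ) := by
  rw [stepSpan, Submodule.map_span, LambdaOdd]
  congr 1
  ext f
  constructor
  · rintro ⟨β, hβ, ⟨c, rfl⟩, rfl⟩
    refine ⟨_, ⟨c - b, rfl⟩, ?_⟩
    simp only
    rw [show 2 * b + 1 + 2 * (c - b) = 2 * c + 1 by omega, map_mul]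
    rfl
  · rintro ⟨_, ⟨j, rfl⟩, rfl⟩
    refine ⟨2 * b + 1 + 2 * j, by omega, ⟨b + j, by ring⟩, ?_⟩
    rw [map_mul]
    rfl

theorem LambdaEven_eq (b : ℕ) : LambdaEven ℓ r (2 * b) m =
    (stepSpan (ZMod (ℓ ^ m)) (redP ℓ r m) (2 * b)).map (mulEta ℓ r m 1) := by
  rw [stepSpan, Submodule.map_span, LambdaEven]
  congr 1
  ext f
  constructor
  · rintro ⟨β, hβ, ⟨c, rfl⟩, rfl⟩
    refine ⟨_, ⟨c - b, rfl⟩, ?_⟩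
    simp only
    rw [show 2 * b + 2 * (c - b) = c + c by omega, map_mul]
    rfl
  · rintro ⟨_, ⟨j, rfl⟩, rfl⟩
    refine ⟨2 * b + 2 * j, by omega, ⟨b + j, by ring⟩, ?_⟩
    rw [map_mul]
    rfl

variable {ℓ r m}

/-- The thresholds of stabilization, in terms of the spans of the `P_ℓ(r, β)` themselves. -/
theorem mem_stableThresholds_iff (hℓ : ℓ ≠ 0) (b' : ℕ) : b' ∈ stableThresholds ℓ r m ↔
    ∀ b c, b' ≤ b → b' ≤ c → b ≡ c [MOD 2] → stepSpan (ZMod (ℓ ^ m)) (redP ℓ r m) b =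
      stepSpan (ZMod (ℓ ^ m)) (redP ℓ r m) c := by
  constructor
  · rintro ⟨h1, h2⟩ b c hb hc hbc
    rw [Nat.ModEq] at hbc
    rcases Nat.even_or_odd' b with ⟨i, rfl | rfl⟩
    · obtain ⟨j, rfl⟩ : ∃ j, c = 2 * j := ⟨c / 2, by omega⟩
      have := h2 i j hb hc
      rw [LambdaEven_eq, LambdaEven_eq] at this
      exact map_mulEta_injective r m one_ne_zero this
    · obtain ⟨j, rfl⟩ : ∃ j, c = 2 * j + 1 := ⟨c / 2, by omega⟩
      have := h1 i j hb hc
      rw [LambdaOdd_eq, LambdaOdd_eq] at this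
      exact map_mulEta_injective r m hℓ this
  · intro h
    refine ⟨fun b c hb hc => ?_, fun b c hb hc => ?_⟩
    · rw [LambdaOdd_eq, LambdaOdd_eq, h _ _ hb hc (by rw [Nat.ModEq]; omega)]
    · rw [LambdaEven_eq, LambdaEven_eq, h _ _ hb hc (by rw [Nat.ModEq]; omega)]

theorem stableThresholds_nonempty (hℓ : ℓ.Prime) (hr : r + 5 ≤ ℓ) (hm : 1 ≤ m) :
    (stableThresholds ℓ r m).Nonempty := by
  obtain ⟨κ, hκ⟩ := exists_forall_reduce_PSeries_mem hℓ hr hm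
  have hfin : Finite (stepSpan (ZMod (ℓ ^ m)) (redP ℓ r m) 2) := by
    have h := finite_formMod (m := m) hℓ.ne_zero κ 0
    refine Set.Finite.subset (s := (formMod ℓ m κ 0 : Set (ZMod (ℓ ^ m))⟦X⟧)) (Set.toFinite _) ?_
    refine Submodule.span_le.mpr ?_
    rintro _ ⟨j, rfl⟩
    have := hκ j
    rwa [add_comm] at this
  have hanti : Antitone fun k => stepSpan (ZMod (ℓ ^ m)) (redP ℓ r m) (2 * k) := by
    intro k l hkl
    obtain ⟨i, rfl⟩ := Nat.exists_eq_add_of_le hkl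
    simp only [mul_add]
    exact stepSpan_add_le _ _ _
  obtain ⟨n, hn⟩ := exists_forall_ge_eq_of_antitone hanti (k := 1) hfin
  refine ⟨2 * n + 1, (mem_stableThresholds_iff hℓ.ne_zero _).mpr fun b c hb hc hbc => ?_⟩
  rw [Nat.ModEq] at hbc
  rcases Nat.even_or_odd' b with ⟨i, rfl | rfl⟩
  · obtain ⟨j, rfl⟩ : ∃ j, c = 2 * j := ⟨c / 2, by omega⟩
    exact (hn i (by omega)).trans (hn j (by omega)).symm
  · obtain ⟨j, rfl⟩ : ∃ j, c = 2 * j + 1 := ⟨c / 2, by omega⟩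
    rw [← map_stepSpan (opU_redP ℓ r m), ← map_stepSpan (opU_redP ℓ r m)]
    exact congr_arg _ ((hn i (by omega)).trans (hn j (by omega)).symm)

/-- Since `U_ℓ` maps the stable odd span onto the stable even one, generators of `Ω_ℓ^odd`
give generators of both. -/
theorem exists_stepSpan_eq (hℓ : ℓ ≠ 0) {b' : ℕ} (hb' : b' ∈ stableThresholds ℓ r m)
    {b : ℕ} (hb : b' ≤ b) {g : (ZMod (ℓ ^ m))⟦X⟧} (hg : OmegaOdd ℓ r m = Submodule.span _ {g}) :
    ∃ f, (g = 0 → f = 0) ∧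
      stepSpan (ZMod (ℓ ^ m)) (redP ℓ r m) b = Submodule.span _ {f} := by
  have hodd : ∀ i, b' ≤ 2 * i + 1 → ∃ f, (g = 0 → f = 0) ∧
      stepSpan (ZMod (ℓ ^ m)) (redP ℓ r m) (2 * i + 1) = Submodule.span _ {f} := by
    intro i hi
    have h1 := OmegaOdd_eq ℓ r m b' i hb' hi
    rw [LambdaOdd_eq, hg] at h1
    obtain ⟨f, -, rfl⟩ := h1.le (Submodule.mem_span_singleton_self g)
    refine ⟨f, fun h0 => ?_, map_mulEta_injective r m hℓ ?_⟩
    · exact mul_etaSeries_injective hℓ r (h0.trans (map_zero (mulEta ℓ r m ℓ)).symm)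
    · rw [← h1, Submodule.map_span, Set.image_singleton]
  rcases Nat.even_or_odd' b with ⟨i, rfl | rfl⟩
  · obtain ⟨f, hf0, hf⟩ := hodd i (by omega)
    refine ⟨opU _ ℓ f, fun h0 => by rw [hf0 h0, map_zero], ?_⟩
    rw [(mem_stableThresholds_iff hℓ b').mp hb' (2 * i) (2 * i + 1 + 1) hb (by omega)
      (by rw [Nat.ModEq]; omega), ← map_stepSpan (opU_redP ℓ r m), hf, Submodule.map_span,
      Set.image_singleton]
  · exact hodd i hb

theorem pPow_modEq_of_redP_eq {b₁ b₂ : ℕ} {C : ℤ}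
    (h : redP ℓ r m b₁ = (C : ZMod (ℓ ^ m)) • redP ℓ r m b₂) (n : ℕ) :
    pPow r (((ℓ : ℚ) ^ b₁ * n + r) / 24) ≡ C * pPow r (((ℓ : ℚ) ^ b₂ * n + r) / 24)
      [ZMOD (ℓ : ℤ) ^ m] := by
  have h1 := congr_arg (coeff n) h
  rw [redP, redP, coeff_smul, coeff_reduce, coeff_reduce, PSeries, PSeries, coeff_mk, coeff_mk,
    smul_eq_mul, ← Int.cast_mul, ZMod.intCast_eq_intCast_iff] at h1
  exact_mod_cast h1

end Lambda

end PartitionPowers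

open PartitionPowers in
theorem corollary1p2 (ℓ r m : ℕ) (hℓ : ℓ.Prime) (hr : 1 ≤ r) (hm : 1 ≤ m) (hℓr : r + 5 ≤ ℓ) :
    (PartitionPowers.stableThresholds ℓ r m).Nonempty ∧
    (PartitionPowers.rankOmega ℓ r m ≤ 1 →
      ∀ b₁ b₂ : ℕ, PartitionPowers.bMin ℓ r m ≤ b₁ → PartitionPowers.bMin ℓ r m ≤ b₂ →
        b₁ ≡ b₂ [MOD 2] →
        ∃ C : ℤ,
          (∀ n : ℕ, PartitionPowers.pPow r (((ℓ : ℚ) ^ b₁ * n + r) / 24) ≡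
            C * PartitionPowers.pPow r (((ℓ : ℚ) ^ b₂ * n + r) / 24) [ZMOD (ℓ : ℤ) ^ m]) ∧
          (PartitionPowers.rankOmega ℓ r m = 0 → C = 0)) := by
  have hne := stableThresholds_nonempty hℓ hℓr hm
  refine ⟨hne, fun hrank b₁ b₂ h1 h2 h12 => ?_⟩
  have hb' : bMin ℓ r m ∈ stableThresholds ℓ r m := Nat.sInf_mem hne
  have hS := (mem_stableThresholds_iff hℓ.ne_zero _).mp hb' b₁ b₂ h1 h2 h12
  by_cases h0 : rankOmega ℓ r m = 0
  · have hg : OmegaOdd ℓ r m = Submodule.span _ {0} := by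
      rw [Submodule.span_zero_singleton]
      exact Submodule.spanRank_eq_zero_iff_eq_bot.mp h0
    obtain ⟨f, hf0, hf⟩ := exists_stepSpan_eq hℓ.ne_zero hb' h1 hg
    rw [hf0 rfl, Submodule.span_zero_singleton] at hf
    have h3 := mem_stepSpan (R := ZMod (ℓ ^ m)) (redP ℓ r m) b₁
    rw [hf, Submodule.mem_bot] at h3
    refine ⟨0, pPow_modEq_of_redP_eq ?_, fun _ => rfl⟩
    rw [h3, Int.cast_zero, zero_smul]
  · obtain ⟨g, hg⟩ := exists_eq_span_singleton_of_spanRank_le_one hrank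
    obtain ⟨f, -, hf⟩ := exists_stepSpan_eq hℓ.ne_zero hb' h2 hg
    have h3 := mem_stepSpan (R := ZMod (ℓ ^ m)) (redP ℓ r m) b₁
    rw [hS, stepSpan_eq_span_singleton (opU_redP ℓ r m) hf] at h3
    obtain ⟨c, hc⟩ := Submodule.mem_span_singleton.mp h3
    obtain ⟨C, rfl⟩ := ZMod.intCast_surjective c
    exact ⟨C, pPow_modEq_of_redP_eq hc.symm, fun h => absurd h h0⟩
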